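/- **Setting.** For every sample size $n$ let $y = X\beta^* + \epsilon$, where $X$ is a nonrandom $n\times p$ design matrix with rows $x_1^T,\dots,x_n^T$, $p=p_n\to\infty$, $\beta^*\in\mathbb R^p$, and $\epsilon_1,\dots,\epsilon_n$ are independent (in particular, possibly i.i.d.) random errors with mean $0$ and variance $\sigma^2$, $0<\sigma<\infty$ fixed. Everything except $\sigma$ may depend on $n$; all limits and order symbols refer to $n\to\infty$, and "uniformly" means with constants that do not depend on $n$. Put $S=\frac1n X^TX$, $\mathcal A=\{j:\beta^*_j\ne0\}$, $a=|\mathcal A|$. Let $$\hat\beta_\lambda\in\arg\min_{\beta\in\mathbb R^p}\Big(\tfrac1{2n}\|y-X\beta\|_2^2+\lambda\|\beta\|_1\Big)$$ be a (measurable) LASSO estimator with $\lambda>0$ nonrandom, let $\kappa$ be the subgradient of $\|\cdot\|_1$ at $\hat\beta_\lambda$ determined by $-\frac1nX^T(y-X\hat\beta_\lambda)+\lambda\kappa=0$, and let $\hat{\mathcal A}=\{j:\hat\beta_{\lambda,j}\neq0\}$, $\hat a=|\hat{\mathcal A}|$. Let $\tilde{\mathcal A}\subset\{1,\dots,p\}$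 be a given (nonrandom) expanded model, $\tilde a=|\tilde{\mathcal A}|$, and $\tau_a,\tau_c>0$. The MOCE estimator is $$\hat\beta_\tau=\hat\beta_\lambda+\lambda L_\tau^{-1}\kappa,\qquad L_\tau=\begin{pmatrix}S_{\tilde{\mathcal A}\tilde{\mathcal A}}+\tau_aI&0\\ S_{\tilde{\mathcal A}^c\tilde{\mathcal A}}&S_{\tilde{\mathcal A}^c\tilde{\mathcal A}^c}+\tau_cI\end{pmatrix}$$ (block form with respect to $\tilde{\mathcal A},\tilde{\mathcal A}^c$). Let $\lambda_{\min}(s)$ and $\lambda_{\max}(s)$ be the minimum and maximum of $\|X\nu\|_2^2/(n\|\nu\|_2^2)$ over $\nu\ne0$ with $\|\nu\|_0\le s$. Let $d\in\mathbb R^p$ with $\|d\|_2=1$ and $\|d\|_0\le m$, where $m$ is fixed, and put $v^2=\sigma^2d^TL_\tau^{-1}S(L_\tau^{-1})^Td$ with $v\ge0$, and $w_i=n^{-1/2}d^TL_\tau^{-1}x_i$. **Theorem 2.** Assume: 1. (restricted eigenvalues) uniformly there is $\phi_0>0$ with $\|X\nu\|_2^2\ge\phi_0\,n\|\nu\|_2^2$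 for all $\nu$ such that $\|\nu_{\mathcal J^c}\|_1\le3\|\nu_{\mathcal J}\|_1$ for some $\mathcal J$ with $|\mathcal J|\le a$; 2. (sparse eigenvalues) for some constants $0<c\le C<\infty$, with probability tending to one, $c\le\lambda_{\min}(s)\le\lambda_{\max}(s)\le C$ for $s=\max(\tilde a,\hat a)$; moreover $\lambda_{\max}(b_{fn})$ is bounded uniformly, where $b_{fn}=|\mathcal A\cap\tilde{\mathcal A}^c|$ is the number of signals missed by $\tilde{\mathcal A}$; 3. $\|\beta^*_{\tilde{\mathcal A}^c\cap\mathcal A_s}\|_2=o(1/\sqrt n)$, where $\mathcal A_s=\{j:|\beta_j^*|>\sigma\sqrt{2\log p}/n\}$; 4. $\sqrt{\hat a}\,\|\hat\beta_{\lambda,\tilde{\mathcal A}^c\cap\hat{\mathcal A}}\|_\infty=o_p(1/\sqrt n)$; 5. for some $r>2$, $\sup_{n}\max_{1\le i\le n}\mathbb E|\epsilon_i|^r<\infty$, and $\lim_{n\to\infty}\max_{1\le i\le n}w_i^2/\sum_{k=1}^nw_k^2=0$; 6. $a=o(n/\log p)$, $\lambda\asymp\sqrt{\log p/n}$, $\tau_a=o(\sqrt{\log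 p}/n)$, $\tau_c=O(\sqrt{\lambda_{\max}(p-\tilde a)})$ with $\tau_c$ bounded away from $0$ uniformly, and $v$ bounded away from $0$ uniformly. Then $$\sqrt n\,v^{-1}d^T(\hat\beta_\tau-\beta^*)=\frac1{\sqrt n}v^{-1}d^TL_\tau^{-1}X^T\epsilon+o_p(1),$$ and $\frac1{\sqrt n}v^{-1}d^TL_\tau^{-1}X^T\epsilon$ converges in distribution to $N(0,1)$; hence so does $\sqrt n\,v^{-1}d^T(\hat\beta_\tau-\beta^*)$. -/

import Mathlib

open MeasureTheory ProbabilityTheory Filter Topology Asymptotics Matrix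

namespace MOCE

/-- The squared Euclidean norm of a real vector. -/
def sqNorm {ι : Type*} [Fintype ι] (u : ι → ℝ) : ℝ := ∑ i, u i ^ 2

/-- The Euclidean norm of a real vector. -/
noncomputable def twoNorm {ι : Type*} [Fintype ι] (u : ι → ℝ) : ℝ := √(sqNorm u)

/-- The support of a vector (for a LASSO solution: the LASSO selected model). -/
noncomputable def support {p : ℕ} (u : Fin p → ℝ) : Finset (Fin p) :=
  Finset.univ.filter fun j => u j ≠ 0

/-- The vector that agrees with `u` on `B` and vanishes off `B`. -/
def restrict {p : ℕ} (B : Finset (Fin p)) (u : Fin p → ℝ) : Fin p → ℝ :=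
  fun j => if j ∈ B then u j else 0

/-- The sample covariance matrix `S = Xᵀ X / n`. -/
noncomputable def sampleCov {n p : ℕ} (X : Matrix (Fin n) (Fin p) ℝ) :
    Matrix (Fin p) (Fin p) ℝ := (1 / (n : ℝ)) • (Xᵀ * X)

/-- The restricted eigenvalue condition `RE(s, k)` with constant `φ₀`: the quotient
`‖X ν‖² / (n ‖ν‖²)` is at least `φ₀` on every cone `‖ν_{Jᶜ}‖₁ ≤ k ‖ν_J‖₁` with `|J| ≤ s`. -/
def RestrictedEigenvalue {n p : ℕ} (X : Matrix (Fin n) (Fin p) ℝ) (s : ℕ) (k φ₀ : ℝ) : Prop :=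
  ∀ J : Finset (Fin p), J.card ≤ s → ∀ ν : Fin p → ℝ, ν ≠ 0 →
    ∑ j ∈ Jᶜ, |ν j| ≤ k * ∑ j ∈ J, |ν j| →
    φ₀ ≤ sqNorm (X *ᵥ ν) / (n * sqNorm ν)

/-- The sparse eigenvalue condition `SE(s)` with constants `c`, `C`, that is
`c ≤ λ_min(s) ≤ λ_max(s) ≤ C`: every nonzero `ν` with `‖ν‖₀ ≤ s` has
`c ≤ ‖X ν‖² / (n ‖ν‖²) ≤ C`. -/
def SparseEigenvalue {n p : ℕ} (X : Matrix (Fin n) (Fin p) ℝ) (s : ℕ) (c C : ℝ) : Prop :=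
  ∀ ν : Fin p → ℝ, ν ≠ 0 → (support ν).card ≤ s →
    c ≤ sqNorm (X *ᵥ ν) / (n * sqNorm ν) ∧ sqNorm (X *ᵥ ν) / (n * sqNorm ν) ≤ C

/-- The maximal sparse eigenvalue `λ_max(s)` (equal to `0` for `s = 0`). -/
noncomputable def sparseEigMax {n p : ℕ} (X : Matrix (Fin n) (Fin p) ℝ) (s : ℕ) : ℝ :=
  sSup {q : ℝ | ∃ ν : Fin p → ℝ, ν ≠ 0 ∧ (support ν).card ≤ s ∧
    q = sqNorm (X *ᵥ ν) / (n * sqNorm ν)}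

/-- The LASSO objective `‖y - X b‖² / (2n) + lam ‖b‖₁`. -/
noncomputable def lassoObjective {n p : ℕ} (X : Matrix (Fin n) (Fin p) ℝ) (y : Fin n → ℝ)
    (lam : ℝ) (b : Fin p → ℝ) : ℝ :=
  1 / (2 * (n : ℝ)) * sqNorm (y - X *ᵥ b) + lam * ∑ j, |b j|

/-- `b` is a LASSO estimator: a global minimizer of the LASSO objective. -/
def IsLasso {n p : ℕ} (X : Matrix (Fin n) (Fin p) ℝ) (y : Fin n → ℝ)
    (lam : ℝ) (b : Fin p → ℝ) : Prop :=
  ∀ b' : Fin p → ℝ, lassoObjective X y lam b ≤ lassoObjective X y lam b'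

/-- The vector `κ` in the Karush-Kuhn-Tucker equation `-(1/n) Xᵀ (y - X b) + lam κ = 0` of a
LASSO estimator `b`; this equation determines `κ`. See `lassoKappa_subgradient`. -/
noncomputable def lassoKappa {n p : ℕ} (X : Matrix (Fin n) (Fin p) ℝ) (y : Fin n → ℝ)
    (lam : ℝ) (b : Fin p → ℝ) : Fin p → ℝ :=
  lam⁻¹ • ((1 / (n : ℝ)) • (Xᵀ *ᵥ (y - X *ᵥ b)))

/-- The matrix `L_τ`, in the coordinates of the full index set: with rows and columns ordered so
that `A` comes first, it is the block matrix
`[[S_{AA} + τₐ I, 0], [S_{AᶜA}, S_{AᶜAᶜ} + τ_c I]]`. -/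
noncomputable def moceL {n p : ℕ} (X : Matrix (Fin n) (Fin p) ℝ) (A : Finset (Fin p))
    (τa τc : ℝ) : Matrix (Fin p) (Fin p) ℝ :=
  Matrix.of fun i j =>
    (if i ∈ A ∧ j ∉ A then 0 else sampleCov X i j) +
      (if i = j then (if i ∈ A then τa else τc) else 0)

/-- The MOCE estimator `b + lam L_τ⁻¹ κ` built from a LASSO estimator `b`. -/
noncomputable def moceEstimator {n p : ℕ} (X : Matrix (Fin n) (Fin p) ℝ) (y : Fin n → ℝ)
    (lam : ℝ) (A : Finset (Fin p)) (τa τc : ℝ) (b : Fin p → ℝ) : Fin p → ℝ :=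
  b + lam • ((moceL X A τa τc)⁻¹ *ᵥ lassoKappa X y lam b)

/-- The variance `v² = σ² dᵀ L_τ⁻¹ S (L_τ⁻¹)ᵀ d`. -/
noncomputable def moceVar {n p : ℕ} (X : Matrix (Fin n) (Fin p) ℝ) (A : Finset (Fin p))
    (τa τc σ : ℝ) (d : Fin p → ℝ) : ℝ :=
  σ ^ 2 * (d ⬝ᵥ
    (((moceL X A τa τc)⁻¹ * sampleCov X * ((moceL X A τa τc)⁻¹)ᵀ) *ᵥ d))

/-- The weight `w_i = n^{-1/2} dᵀ L_τ⁻¹ x_i`, where `x_i` is the `i`-th row of `X`. -/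
noncomputable def moceWeight {n p : ℕ} (X : Matrix (Fin n) (Fin p) ℝ) (A : Finset (Fin p))
    (τa τc : ℝ) (d : Fin p → ℝ) (i : Fin n) : ℝ :=
  1 / √(n : ℝ) * (d ⬝ᵥ ((moceL X A τa τc)⁻¹ *ᵥ X i))

/-- The studentized estimation error `√n v⁻¹ dᵀ (b̂ - β)`. -/
noncomputable def studentized {p : ℕ} (n : ℕ) (v : ℝ) (d bhat β : Fin p → ℝ) : ℝ :=
  √(n : ℝ) * v⁻¹ * (d ⬝ᵥ (bhat - β))

/-- The leading term `n^{-1/2} v⁻¹ dᵀ L_τ⁻¹ Xᵀ e`. -/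
noncomputable def leadingTerm {n p : ℕ} (X : Matrix (Fin n) (Fin p) ℝ) (A : Finset (Fin p))
    (τa τc v : ℝ) (d : Fin p → ℝ) (e : Fin n → ℝ) : ℝ :=
  1 / √(n : ℝ) * v⁻¹ * (d ⬝ᵥ ((moceL X A τa τc)⁻¹ *ᵥ (Xᵀ *ᵥ e)))

/-- The signal set `A_s = {j : |β_j| > λ_s σ}` with `λ_s = √(2 log p) / n`. -/
noncomputable def signalSet {p : ℕ} (n : ℕ) (σ : ℝ) (β : Fin p → ℝ) : Finset (Fin p) :=
  Finset.univ.filter fun j => √(2 * Real.log p) / n * σ < |β j|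

lemma lassoObjective_perturb {n p : ℕ} (X : Matrix (Fin n) (Fin p) ℝ) (y : Fin n → ℝ)
    {lam : ℝ} (hlam : 0 < lam) (b : Fin p → ℝ) (j : Fin p) (t : ℝ) :
    lassoObjective X y lam (b + Pi.single j t) = lassoObjective X y lam b
      - t * (lam * lassoKappa X y lam b j)
      + t ^ 2 * (1 / (2 * (n : ℝ)) * sqNorm (X.col j)) + lam * (|b j + t| - |b j|) := by
  have h1 : y - X *ᵥ (b + Pi.single j t) = fun i => (y - X *ᵥ b) i - t * X i j := by
    ext i
    simp [Matrix.mulVec_add, Matrix.mulVec_single]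
    ring
  have h2 : ∑ k, |(b + Pi.single j t : Fin p → ℝ) k| = ∑ k, |b k| + (|b j + t| - |b j|) := by
    rw [← sub_eq_iff_eq_add', ← Finset.sum_sub_distrib, Finset.sum_eq_single j]
    · simp
    · intro k _ hk
      simp [hk]
    · simp
  have h3 : lam * lassoKappa X y lam b j = (1 / (n : ℝ)) * ∑ i, X i j * (y - X *ᵥ b) i := by
    simp only [lassoKappa, Pi.smul_apply, smul_eq_mul, mulVec, dotProduct, transpose_apply]
    field_simp
  have h4 : sqNorm (fun i => (y - X *ᵥ b) i - t * X i j) = sqNorm (y - X *ᵥ b)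
      - 2 * t * ∑ i, X i j * (y - X *ᵥ b) i + t ^ 2 * sqNorm (X.col j) := by
    simp only [sqNorm, Finset.mul_sum, ← Finset.sum_sub_distrib, ← Finset.sum_add_distrib, col]
    refine Finset.sum_congr rfl fun i _ => ?_
    simp only [transpose_apply]
    ring
  simp only [lassoObjective]
  rw [h1, h2, h3, h4]
  have : (1 / (2 * (n : ℝ))) * 2 = 1 / (n : ℝ) := by
    rcases eq_or_ne (n : ℝ) 0 with h | h
    · simp [h]
    · field_simp
  rw [← this]
  ring

/-- `κ` is a subgradient of the `ℓ₁`-norm at the LASSO estimator. -/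
theorem lassoKappa_subgradient {n p : ℕ} (X : Matrix (Fin n) (Fin p) ℝ) (y : Fin n → ℝ)
    {lam : ℝ} (hlam : 0 < lam) {b : Fin p → ℝ} (hb : IsLasso X y lam b) (j : Fin p) :
    (0 < b j → lassoKappa X y lam b j = 1) ∧ (b j < 0 → lassoKappa X y lam b j = -1) ∧
      |lassoKappa X y lam b j| ≤ 1 := by
  set κ := lassoKappa X y lam b j with hκ
  set K := 1 / (2 * (n : ℝ)) * sqNorm (X.col j) with hK
  have hK0 : 0 ≤ K := mul_nonneg (by positivity) (Finset.sum_nonneg fun i _ => sq_nonneg _)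
  have key : ∀ t : ℝ, 0 ≤ -(t * (lam * κ)) + t ^ 2 * K + lam * (|b j + t| - |b j|) := by
    intro t
    have h := hb (b + Pi.single j t)
    rw [lassoObjective_perturb X y hlam b j t] at h
    linarith
  -- a one-sided limit: `0 ≤ x + s K` for all small `s > 0` forces `0 ≤ x`
  have lim : ∀ x δ : ℝ, 0 < δ → (∀ s, 0 < s → s < δ → 0 ≤ x + s * K) → 0 ≤ x := by
    intro x δ hδ h
    by_contra! hx
    have hs : 0 < min (δ / 2) (-x / (2 * (K + 1))) :=
      lt_min (by linarith) (div_pos (by linarith) (by linarith))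
    have h1 := h _ hs (lt_of_le_of_lt (min_le_left _ _) (by linarith))
    have h2 : min (δ / 2) (-x / (2 * (K + 1))) * (2 * (K + 1)) ≤ -x := by
      rw [← le_div_iff₀ (by linarith)]
      exact min_le_right _ _
    nlinarith
  have hle : κ ≤ 1 := by
    have := lim (lam * (1 - κ)) 1 one_pos fun s hs _ => by
      have h1 := key s
      have h2 : |b j + s| - |b j| ≤ s := by
        have := abs_add_le (b j) s
        rw [abs_of_pos hs] at this
        linarith
      have h3 := mul_le_mul_of_nonneg_left h2 hlam.le
      have h4 : 0 ≤ s * (lam * (1 - κ) + s * K) := by nlinarith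
      exact nonneg_of_mul_nonneg_right h4 hs
    have := nonneg_of_mul_nonneg_right this hlam
    linarith
  have hge : -1 ≤ κ := by
    have := lim (lam * (1 + κ)) 1 one_pos fun s hs _ => by
      have h1 := key (-s)
      have h2 : |b j + -s| - |b j| ≤ s := by
        have := abs_add_le (b j) (-s)
        rw [abs_neg, abs_of_pos hs] at this
        linarith
      have h3 := mul_le_mul_of_nonneg_left h2 hlam.le
      have h4 : 0 ≤ s * (lam * (1 + κ) + s * K) := by nlinarith
      exact nonneg_of_mul_nonneg_right h4 hs
    have := nonneg_of_mul_nonneg_right this hlam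
    linarith
  refine ⟨fun hbj => ?_, fun hbj => ?_, abs_le.mpr ⟨hge, hle⟩⟩
  · have := lim (lam * (κ - 1)) (b j) hbj fun s hs hsb => by
      have h1 := key (-s)
      rw [abs_of_pos hbj, abs_of_pos (by linarith)] at h1
      have h4 : 0 ≤ s * (lam * (κ - 1) + s * K) := by nlinarith
      exact nonneg_of_mul_nonneg_right h4 hs
    have := nonneg_of_mul_nonneg_right this hlam
    linarith
  · have := lim (lam * (-1 - κ)) (-b j) (by linarith) fun s hs hsb => by
      have h1 := key s
      rw [abs_of_neg hbj, abs_of_neg (by linarith)] at h1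
      have h4 : 0 ≤ s * (lam * (-1 - κ) + s * K) := by nlinarith
      exact nonneg_of_mul_nonneg_right h4 hs
    have := nonneg_of_mul_nonneg_right this hlam
    linarith

end MOCE

/-! Write `Δ = b - β` and `u = (L⁻¹)ᵀ d`. The KKT equation gives `lam κ = Xᵀε/n - S Δ`, so the
difference between the studentized error and the leading term is exactly `√n v⁻¹ u·(L - S)Δ`
(`studentized_sub_leadingTerm`). The matrix `L - S` consists of the ridge `τa` on `A`, minus the
block of `S` in rows `A` and columns `Aᶜ`, plus the ridge `τc` on `Aᶜ`.

Testing `u·Lz = d·z` with the two restrictions of `u` bounds `u` on `Aᶜ` in Euclidean and prediction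
norm, then on `A` (`twoNorm_restrict_compl_le`, `twoNorm_restrict_le_of_sparse`). Only the part on
`A` uses sparse eigenvalues; the part on `Aᶜ` may be dense. Hence `abs_remainder_le`: the remainder
is controlled by `τa ‖Δ‖` and the size of `Δ` on `Aᶜ`.

Since `√n τa = o(lam)`, it is enough that `‖Δ‖ = O_p(1/lam)`. This crude rate follows from
restricted eigenvalues and `E‖ε‖²/n = σ²`, with no event on which `lam` dominates the noise
(`IsLasso.mul_twoNorm_sub_le`). On `Aᶜ`, `Δ` splits into LASSO leakage, strong missed signals, both
negligible by assumption, and weak missed signals, negligible by their size and number.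

The leading term is a weighted sum of the errors with variance exactly one, so Lyapunov's theorem
`tendstoInDistribution_weighted_sum` applies; Slutsky's theorem transfers its limit. -/

namespace MOCE

/-! ### Elementary estimates for characteristic functions. -/

lemma norm_prod_sub_prod_le {ι : Type*} (s : Finset ι) (f g : ι → ℂ)
    (hf : ∀ i ∈ s, ‖f i‖ ≤ 1) (hg : ∀ i ∈ s, ‖g i‖ ≤ 1) :
    ‖∏ i ∈ s, f i - ∏ i ∈ s, g i‖ ≤ ∑ i ∈ s, ‖f i - g i‖ := by
  classical
  induction s using Finset.induction with
  | empty => simp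
  | insert a s ha ih =>
    rw [Finset.prod_insert ha, Finset.prod_insert ha, Finset.sum_insert ha]
    have ih' := ih (fun i hi => hf i (Finset.mem_insert_of_mem hi))
      (fun i hi => hg i (Finset.mem_insert_of_mem hi))
    have hfa := hf a (Finset.mem_insert_self a s)
    have hgs : ‖∏ i ∈ s, g i‖ ≤ 1 := by
      rw [norm_prod]
      exact Finset.prod_le_one (fun _ _ => norm_nonneg _)
        fun i hi => hg i (Finset.mem_insert_of_mem hi)
    -- Telescoping: one factor is exchanged at a time, the others having norm at most one.
    calc ‖f a * ∏ i ∈ s, f i - g a * ∏ i ∈ s, g i‖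
        = ‖f a * (∏ i ∈ s, f i - ∏ i ∈ s, g i) + (f a - g a) * ∏ i ∈ s, g i‖ := by ring_nf
      _ ≤ ‖f a‖ * ‖∏ i ∈ s, f i - ∏ i ∈ s, g i‖ + ‖f a - g a‖ * ‖∏ i ∈ s, g i‖ := by
        rw [← norm_mul, ← norm_mul]; exact norm_add_le _ _
      _ ≤ 1 * ‖∏ i ∈ s, f i - ∏ i ∈ s, g i‖ + ‖f a - g a‖ * 1 := by gcongr
      _ ≤ _ := by linarith

/-- For `|x| ≤ 1` the Taylor remainder is cubic and `s ≤ 3`; for `|x| > 1` the trivial bound is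
quadratic and `2 ≤ s`. The intermediate exponent is what moments of order only slightly above two
require. -/
lemma norm_exp_mul_I_sub_le {s : ℝ} (hs2 : 2 ≤ s) (hs3 : s ≤ 3) (x : ℝ) :
    ‖Complex.exp (x * Complex.I) - (1 + x * Complex.I - x ^ 2 / 2)‖ ≤ 4 * |x| ^ s := by
  rcases le_or_gt |x| 1 with hx | hx
  · have h := Complex.exp_bound (x := x * Complex.I) (by simpa using hx) (n := 3) (by norm_num)
    have hsum : ∑ m ∈ Finset.range 3, (x * Complex.I) ^ m / (m.factorial : ℂ)
        = 1 + x * Complex.I - x ^ 2 / 2 := by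
      simp [Finset.sum_range_succ, mul_pow]
      ring
    rw [hsum] at h
    refine h.trans ?_
    have h3 : |x| ^ 3 ≤ |x| ^ s := by
      rcases eq_or_ne x 0 with rfl | hx0
      · simp [Real.zero_rpow (by linarith : s ≠ 0)]
      · rw [← Real.rpow_natCast]
        exact Real.rpow_le_rpow_of_exponent_ge (abs_pos.2 hx0) hx (by exact_mod_cast hs3)
    have h0 : 0 ≤ |x| ^ s := by positivity
    simp only [norm_mul, Complex.norm_real, Complex.norm_I, mul_one, Real.norm_eq_abs]
    norm_num [Nat.factorial]
    linarith
  · have h2 : |x| ^ 2 ≤ |x| ^ s := by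
      rw [← Real.rpow_natCast]
      exact Real.rpow_le_rpow_of_exponent_le hx.le (by exact_mod_cast hs2)
    have hb : ‖(1 : ℂ) + x * Complex.I - x ^ 2 / 2‖ ≤ 1 + |x| + |x| ^ 2 / 2 := by
      refine (norm_sub_le _ _).trans (add_le_add ((norm_add_le _ _).trans ?_) ?_) <;> simp
    calc _ ≤ ‖Complex.exp (x * Complex.I)‖ + ‖(1 : ℂ) + x * Complex.I - x ^ 2 / 2‖ :=
          norm_sub_le _ _
      _ ≤ 1 + (1 + |x| + |x| ^ 2 / 2) := by
        rw [Complex.norm_exp_ofReal_mul_I]; gcongr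
      _ ≤ 4 * |x| ^ 2 := by nlinarith
      _ ≤ _ := by linarith

lemma abs_exp_neg_sub_le {u : ℝ} (hu : 0 ≤ u) : |Real.exp (-u) - (1 - u)| ≤ u ^ 2 := by
  rcases le_or_gt u 1 with h | h
  · have := Real.abs_exp_sub_one_sub_id_le (x := -u) (by rwa [abs_neg, abs_of_nonneg hu])
    rw [neg_sq] at this
    convert this using 2
    ring
  · have h1 : Real.exp (-u) ≤ 1 := Real.exp_le_one_iff.2 (by linarith)
    have h2 := Real.exp_pos (-u)
    rw [abs_le]
    constructor <;> nlinarith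

/-! ### Lyapunov's central limit theorem for triangular arrays. -/

section CLT

variable {Ω : Type*} [MeasurableSpace Ω] {μ : Measure Ω} [IsProbabilityMeasure μ]

/-- The pointwise Taylor estimate is integrated; the linear term vanishes because `Y` is centred. -/
lemma norm_charFun_sub_le {Y : Ω → ℝ} (hY : Measurable Y) (hY2 : MemLp Y 2 μ)
    (h0 : μ[Y] = 0) {s : ℝ} (hs2 : 2 ≤ s) (hs3 : s ≤ 3)
    (hs : Integrable (fun ω => |Y ω| ^ s) μ) (t : ℝ) :
    ‖charFun (μ.map Y) t - ((1 - t ^ 2 * (∫ ω, Y ω ^ 2 ∂μ) / 2 : ℝ) : ℂ)‖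
      ≤ 4 * |t| ^ s * ∫ ω, |Y ω| ^ s ∂μ := by
  have hY1 : Integrable Y μ := hY2.integrable (by norm_num)
  have hYsq : Integrable (fun ω => Y ω ^ 2) μ := hY2.integrable_sq
  have hexp : Integrable (fun ω => Complex.exp ((t * Y ω : ℝ) * Complex.I)) μ := by
    refine Integrable.of_bound (C := 1) (by fun_prop) (ae_of_all _ fun ω => ?_)
    rw [Complex.norm_exp_ofReal_mul_I]
  have hq : Integrable
      (fun ω => (1 : ℂ) + (t * Y ω : ℝ) * Complex.I - ((t * Y ω : ℝ) : ℂ) ^ 2 / 2) μ := by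
    refine ((integrable_const _).add ?_).sub ?_
    · exact ((hY1.const_mul t).ofReal (𝕜 := ℂ)).mul_const Complex.I
    · have : Integrable (fun ω => ((t ^ 2 * Y ω ^ 2 : ℝ) : ℂ) / 2) μ :=
        ((hYsq.const_mul (t ^ 2)).ofReal (𝕜 := ℂ)).div_const 2
      refine this.congr (ae_of_all _ fun ω => ?_)
      push_cast
      ring
  have hqi : ∫ ω, ((1 : ℂ) + (t * Y ω : ℝ) * Complex.I - ((t * Y ω : ℝ) : ℂ) ^ 2 / 2) ∂μ
      = ((1 - t ^ 2 * (∫ ω, Y ω ^ 2 ∂μ) / 2 : ℝ) : ℂ) := by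
    have i1 : Integrable (fun ω => ((t * Y ω : ℝ) : ℂ) * Complex.I) μ :=
      ((hY1.const_mul t).ofReal (𝕜 := ℂ)).mul_const Complex.I
    have i2 : Integrable (fun ω => ((t ^ 2 * Y ω ^ 2 : ℝ) : ℂ) / 2) μ :=
      ((hYsq.const_mul (t ^ 2)).ofReal (𝕜 := ℂ)).div_const 2
    have i3 : Integrable (fun ω => (1 : ℂ) + ((t * Y ω : ℝ) : ℂ) * Complex.I) μ :=
      (integrable_const _).add i1
    have e : (fun ω => (1 : ℂ) + (t * Y ω : ℝ) * Complex.I - ((t * Y ω : ℝ) : ℂ) ^ 2 / 2)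
        = fun ω => ((1 : ℂ) + (t * Y ω : ℝ) * Complex.I) - ((t ^ 2 * Y ω ^ 2 : ℝ) : ℂ) / 2 := by
      ext ω; push_cast; ring
    rw [e, integral_sub i3 i2,
      integral_add (integrable_const _) i1, integral_mul_const, integral_div,
      integral_complex_ofReal, integral_complex_ofReal, integral_const_mul, integral_const_mul, h0]
    simp
  rw [← hqi, charFun_apply_real, integral_map hY.aemeasurable (by fun_prop)]
  have e2 : ∫ ω, Complex.exp (t * Y ω * Complex.I) ∂μ
      = ∫ ω, Complex.exp ((t * Y ω : ℝ) * Complex.I) ∂μ := by simp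
  rw [e2, ← integral_sub hexp hq, ← integral_const_mul]
  refine norm_integral_le_of_norm_le (hs.const_mul _) (ae_of_all _ fun ω => ?_)
  refine (norm_exp_mul_I_sub_le hs2 hs3 (t * Y ω)).trans (le_of_eq ?_)
  rw [abs_mul, Real.mul_rpow (abs_nonneg _) (abs_nonneg _), mul_assoc]

/-- Lyapunov's central limit theorem for weighted sums of independent variables. -/
theorem tendstoInDistribution_weighted_sum (ε : (n : ℕ) → Fin n → Ω → ℝ) {σ : ℝ} (hσ : 0 < σ)
    (hε_meas : ∀ n i, Measurable (ε n i)) (hε_indep : ∀ n, iIndepFun (ε n) μ)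
    (hε_mean : ∀ n i, μ[ε n i] = 0) (hε_var : ∀ n i, Var[ε n i; μ] = σ ^ 2)
    {r : ℝ} (hr : 2 < r)
    (hmom : ∃ M : ℝ, ∀ n i, Integrable (fun ω => |ε n i ω| ^ r) μ ∧
      ∫ ω, |ε n i ω| ^ r ∂μ ≤ M)
    (c : (n : ℕ) → Fin n → ℝ) (hc : ∀ᶠ n in atTop, σ ^ 2 * ∑ i, c n i ^ 2 = 1)
    (hmax : Tendsto (fun n => ⨆ i, c n i ^ 2) atTop (𝓝 0)) :
    TendstoInDistribution (fun (n : ℕ) ω => ∑ i, c n i * ε n i ω) atTop id (fun _ => μ)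
      (gaussianReal 0 1) := by
  obtain ⟨M, hM⟩ := hmom
  have hL2 : ∀ n i, MemLp (ε n i) 2 μ := fun n i =>
    memLp_two_of_variance_ne_zero (hε_meas n i).aestronglyMeasurable
      (by rw [hε_var]; positivity)
  have hsq : ∀ n i, ∫ ω, ε n i ω ^ 2 ∂μ = σ ^ 2 := fun n i => by
    rw [← hε_var n i, variance_of_integral_eq_zero (hε_meas n i).aemeasurable (hε_mean n i)]
  -- Capping the exponent at 3 keeps the Taylor estimate valid; the moments stay bounded because
  -- `|x| ^ s ≤ 1 + |x| ^ r`.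
  set s := min r 3 with hs
  have hs2 : 2 < s := lt_min hr (by norm_num)
  have hs3 : s ≤ 3 := min_le_right _ _
  have hle : ∀ x : ℝ, |x| ^ s ≤ 1 + |x| ^ r := fun x => by
    rcases le_or_gt |x| 1 with h | h
    · have h1 : |x| ^ s ≤ 1 := Real.rpow_le_one (abs_nonneg _) h (by linarith)
      have h2 : 0 ≤ |x| ^ r := by positivity
      linarith
    · have := Real.rpow_le_rpow_of_exponent_le h.le (min_le_left r 3)
      linarith
  have hint : ∀ n i, Integrable (fun ω => |ε n i ω| ^ s) μ := fun n i => by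
    refine ((integrable_const 1).add (hM n i).1).mono'
      (((hε_meas n i).abs.pow_const s).aestronglyMeasurable) (ae_of_all _ fun ω => ?_)
    rw [Real.norm_of_nonneg (by positivity)]
    exact hle _
  have hmom : ∀ n i, ∫ ω, |ε n i ω| ^ s ∂μ ≤ 1 + M := fun n i => by
    calc _ ≤ ∫ ω, (1 + |ε n i ω| ^ r) ∂μ :=
          integral_mono (hint n i) ((integrable_const 1).add (hM n i).1) fun ω => hle _
      _ = 1 + ∫ ω, |ε n i ω| ^ r ∂μ := by
          rw [integral_add (integrable_const 1) (hM n i).1]; simp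
      _ ≤ _ := by linarith [(hM n i).2]
  have hmeas : ∀ n, Measurable fun ω => ∑ i, c n i * ε n i ω := fun n =>
    Finset.measurable_sum _ fun i _ => (hε_meas n i).const_mul _
  refine ⟨fun n => (hmeas n).aemeasurable, by fun_prop, ?_⟩
  refine ProbabilityMeasure.tendsto_iff_tendsto_charFun.2 fun t => ?_
  have hcf : ∀ n, charFun (μ.map fun ω => ∑ i, c n i * ε n i ω) t
      = ∏ i, charFun (μ.map (ε n i)) (c n i * t) := fun n => by
    have hind : iIndepFun (fun i ω => c n i * ε n i ω) μ :=
      (hε_indep n).comp (fun i x => c n i * x) fun i => by fun_prop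
    rw [hind.charFun_map_fun_sum_eq_prod fun i => ((hε_meas n i).const_mul _).aemeasurable,
      Finset.prod_apply]
    exact Finset.prod_congr rfl fun i _ => charFun_map_mul_comp (hε_meas n i).aemeasurable _ _
  simp only [ProbabilityMeasure.coe_mk, Measure.map_id, hcf, charFun_gaussianReal]
  -- Each factor contributes a Taylor error and a Gaussian error. Both are at most `c n i ^ 2`,
  -- which sums to `1 / σ ^ 2`, times a positive power of the largest squared coefficient.
  have hbound : ∀ᶠ n in atTop, ‖∏ i, charFun (μ.map (ε n i)) (c n i * t)
        - Complex.exp (t * (0 : ℝ) * Complex.I - ((1 : NNReal) : ℝ) * t ^ 2 / 2)‖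
      ≤ 4 * (1 + M) * |t| ^ s * (σ ^ 2)⁻¹ * (⨆ i, c n i ^ 2) ^ ((s - 2) / 2)
        + σ ^ 2 * t ^ 4 / 4 * ⨆ i, c n i ^ 2 := by
    filter_upwards [hc] with n hn
    set K := ⨆ i, c n i ^ 2 with hK
    have hcK : ∀ i, c n i ^ 2 ≤ K := fun i =>
      le_ciSup (f := fun i => c n i ^ 2) (Set.finite_range _).bddAbove i
    have hK0 : 0 ≤ K := Real.iSup_nonneg fun i => sq_nonneg _
    have hsum : ∑ i, c n i ^ 2 = (σ ^ 2)⁻¹ := by field_simp at hn ⊢; linarith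
    -- The limit is factored into Gaussian characteristic functions with the variances of the
    -- summands, to be compared factor by factor.
    have hprod : Complex.exp (t * (0 : ℝ) * Complex.I - ((1 : NNReal) : ℝ) * t ^ 2 / 2)
        = ∏ i, ((Real.exp (-(σ ^ 2 * (c n i * t) ^ 2 / 2)) : ℝ) : ℂ) := by
      rw [← Complex.ofReal_prod, ← Real.exp_sum]
      have : ∑ i, -(σ ^ 2 * (c n i * t) ^ 2 / 2) = -(t ^ 2 / 2) := by
        calc _ = -(t ^ 2 / 2) * (σ ^ 2 * ∑ i, c n i ^ 2) := by
              simp only [Finset.mul_sum]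
              exact Finset.sum_congr rfl fun i _ => by ring
          _ = _ := by rw [hn, mul_one]
      rw [this, Complex.ofReal_exp]
      congr 1
      push_cast
      ring
    rw [hprod]
    have hterm : ∀ i, ‖charFun (μ.map (ε n i)) (c n i * t)
          - ((Real.exp (-(σ ^ 2 * (c n i * t) ^ 2 / 2)) : ℝ) : ℂ)‖
        ≤ (4 * (1 + M) * |t| ^ s * K ^ ((s - 2) / 2) + σ ^ 4 * t ^ 4 / 4 * K) * c n i ^ 2 := by
      intro i
      have h1 := norm_charFun_sub_le (hε_meas n i) (hL2 n i) (hε_mean n i) hs2.le hs3 (hint n i)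
        (c n i * t)
      rw [hsq] at h1
      have h2 := abs_exp_neg_sub_le (u := σ ^ 2 * (c n i * t) ^ 2 / 2) (by positivity)
      have h3 : |c n i| ^ s ≤ c n i ^ 2 * K ^ ((s - 2) / 2) := by
        calc |c n i| ^ s = (|c n i| ^ (2 : ℝ)) ^ (1 + (s - 2) / 2) := by
              rw [← Real.rpow_mul (abs_nonneg _)]; congr 1; ring
          _ = (c n i ^ 2) ^ (1 + (s - 2) / 2) := by
              rw [Real.rpow_two, sq_abs]
          _ = c n i ^ 2 * (c n i ^ 2) ^ ((s - 2) / 2) := by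
              rw [Real.rpow_one_add' (sq_nonneg _) (by linarith)]
          _ ≤ _ := by
              gcongr
              exact hcK i
      have h4 : |c n i * t| ^ s ≤ |t| ^ s * (c n i ^ 2 * K ^ ((s - 2) / 2)) := by
        rw [abs_mul, Real.mul_rpow (abs_nonneg _) (abs_nonneg _), mul_comm]
        gcongr
      have hM0 : 0 ≤ ∫ ω, |ε n i ω| ^ s ∂μ := integral_nonneg fun ω => by positivity
      calc _ ≤ ‖charFun (μ.map (ε n i)) (c n i * t)
              - ((1 - (c n i * t) ^ 2 * σ ^ 2 / 2 : ℝ) : ℂ)‖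
            + ‖((1 - (c n i * t) ^ 2 * σ ^ 2 / 2 : ℝ) : ℂ)
              - ((Real.exp (-(σ ^ 2 * (c n i * t) ^ 2 / 2)) : ℝ) : ℂ)‖ :=
            norm_sub_le_norm_sub_add_norm_sub _ _ _
        _ ≤ 4 * (|t| ^ s * (c n i ^ 2 * K ^ ((s - 2) / 2))) * (1 + M)
            + (σ ^ 2 * (c n i * t) ^ 2 / 2) ^ 2 := by
            refine add_le_add (h1.trans ?_) ?_
            · gcongr
              exact hmom n i
            · rw [← Complex.ofReal_sub, Complex.norm_real, Real.norm_eq_abs, abs_sub_comm,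
                mul_comm _ (σ ^ 2)]
              exact h2
        _ = 4 * (1 + M) * |t| ^ s * K ^ ((s - 2) / 2) * c n i ^ 2
            + σ ^ 4 * t ^ 4 / 4 * c n i ^ 2 * c n i ^ 2 := by ring
        _ ≤ 4 * (1 + M) * |t| ^ s * K ^ ((s - 2) / 2) * c n i ^ 2
            + σ ^ 4 * t ^ 4 / 4 * K * c n i ^ 2 := by
            gcongr
            exact hcK i
        _ = _ := by ring
    have hprob : ∀ i, IsProbabilityMeasure (μ.map (ε n i)) := fun i =>
      Measure.isProbabilityMeasure_map (hε_meas n i).aemeasurable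
    refine (norm_prod_sub_prod_le _ _ _ (fun i _ => norm_charFun_le_one _) fun i _ => ?_).trans ?_
    · rw [Complex.norm_real, Real.norm_of_nonneg (Real.exp_pos _).le, Real.exp_le_one_iff]
      have : 0 ≤ σ ^ 2 * (c n i * t) ^ 2 / 2 := by positivity
      linarith
    · refine (Finset.sum_le_sum fun i _ => hterm i).trans (le_of_eq ?_)
      rw [← Finset.mul_sum, hsum]
      field_simp
  rw [tendsto_iff_norm_sub_tendsto_zero]
  refine squeeze_zero' (Eventually.of_forall fun _ => norm_nonneg _) hbound ?_
  have hp := (hmax.rpow_const (p := (s - 2) / 2) (Or.inr (by linarith))).const_mul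
    (4 * (1 + M) * |t| ^ s * (σ ^ 2)⁻¹)
  have := hp.add (hmax.const_mul (σ ^ 2 * t ^ 4 / 4))
  rwa [Real.zero_rpow (by linarith), mul_zero, mul_zero, add_zero] at this

end CLT

/-! ### Euclidean norm inequalities. -/

section Norms

variable {ι : Type*} [Fintype ι]

lemma sqNorm_nonneg (u : ι → ℝ) : 0 ≤ sqNorm u := Finset.sum_nonneg fun _ _ => sq_nonneg _

lemma sq_twoNorm (u : ι → ℝ) : twoNorm u ^ 2 = sqNorm u := Real.sq_sqrt (sqNorm_nonneg u)

lemma twoNorm_nonneg (u : ι → ℝ) : 0 ≤ twoNorm u := Real.sqrt_nonneg _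

lemma dotProduct_self_eq_sqNorm (u : ι → ℝ) : u ⬝ᵥ u = sqNorm u :=
  Finset.sum_congr rfl fun _ _ => (sq _).symm

lemma twoNorm_eq_norm (u : ι → ℝ) : twoNorm u = ‖WithLp.toLp 2 u‖ := by
  simp [EuclideanSpace.norm_eq, twoNorm, sqNorm]

lemma twoNorm_add_le (u w : ι → ℝ) : twoNorm (u + w) ≤ twoNorm u + twoNorm w := by
  simp only [twoNorm_eq_norm, WithLp.toLp_add]
  exact norm_add_le _ _

lemma twoNorm_sub_le (u w : ι → ℝ) : twoNorm (u - w) ≤ twoNorm u + twoNorm w := by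
  simp only [twoNorm_eq_norm, WithLp.toLp_sub]
  exact norm_sub_le _ _

lemma abs_dotProduct_le (u w : ι → ℝ) : |u ⬝ᵥ w| ≤ twoNorm u * twoNorm w := by
  refine abs_le_of_sq_le_sq ?_ (mul_nonneg (twoNorm_nonneg u) (twoNorm_nonneg w))
  rw [mul_pow, sq_twoNorm, sq_twoNorm]
  exact Finset.sum_mul_sq_le_sq_mul_sq _ _ _

lemma dotProduct_le (u w : ι → ℝ) : u ⬝ᵥ w ≤ twoNorm u * twoNorm w :=
  (le_abs_self _).trans (abs_dotProduct_le u w)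

lemma twoNorm_pos {u : ι → ℝ} (hu : u ≠ 0) : 0 < twoNorm u := by
  rw [twoNorm_eq_norm, norm_pos_iff]
  simpa using hu

lemma twoNorm_zero : twoNorm (0 : ι → ℝ) = 0 := by simp [twoNorm, sqNorm]

lemma twoNorm_le_sum_abs (u : ι → ℝ) : twoNorm u ≤ ∑ j, |u j| := by
  refine Real.sqrt_le_iff.2 ⟨Finset.sum_nonneg fun _ _ => abs_nonneg _, ?_⟩
  calc sqNorm u = ∑ j, |u j| ^ 2 := by simp [sqNorm]
    _ ≤ _ := Finset.sum_sq_le_sq_sum_of_nonneg fun _ _ => abs_nonneg _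

lemma sum_abs_le_sqrt_card_mul (J : Finset ι) (u : ι → ℝ) :
    ∑ j ∈ J, |u j| ≤ √(J.card : ℝ) * twoNorm u := by
  refine le_of_sq_le_sq ?_ (mul_nonneg (Real.sqrt_nonneg _) (twoNorm_nonneg u))
  rw [mul_pow, Real.sq_sqrt (Nat.cast_nonneg _), sq_twoNorm]
  refine sq_sum_le_card_mul_sum_sq.trans ?_
  gcongr
  simp only [sq_abs]
  exact Finset.sum_le_sum_of_subset_of_nonneg (Finset.subset_univ J) fun _ _ _ => sq_nonneg _

lemma twoNorm_le_sqrt_card_mul {J : Finset ι} {u : ι → ℝ} {B : ℝ} (hB : 0 ≤ B)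
    (h0 : ∀ j ∉ J, u j = 0) (h : ∀ j, |u j| ≤ B) : twoNorm u ≤ √(J.card : ℝ) * B := by
  rw [twoNorm]
  refine Real.sqrt_le_iff.2 ⟨by positivity, ?_⟩
  rw [mul_pow, Real.sq_sqrt (Nat.cast_nonneg _), sqNorm,
    ← Finset.sum_subset (Finset.subset_univ J) fun j _ hj => by simp [h0 j hj], ← nsmul_eq_mul]
  refine Finset.sum_le_card_nsmul _ _ _ fun j _ => ?_
  rw [← sq_abs]
  gcongr
  exact h j

end Norms

/-! ### Restriction to coordinate sets. -/

section Restrict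

variable {p : ℕ}

lemma restrict_add_restrict_compl (B : Finset (Fin p)) (u : Fin p → ℝ) :
    restrict B u + restrict Bᶜ u = u := by
  ext j
  by_cases h : j ∈ B <;> simp [restrict, h]

lemma card_support_restrict_le (B : Finset (Fin p)) (u : Fin p → ℝ) :
    (support (restrict B u)).card ≤ B.card :=
  Finset.card_le_card fun j hj => by
    by_contra h
    simp [support, restrict, h] at hj

lemma support_restrict (B : Finset (Fin p)) (u : Fin p → ℝ) :
    support (restrict B u) = support u ∩ B := by
  ext j
  simp [support, restrict, and_comm]

lemma restrict_sub (B : Finset (Fin p)) (u w : Fin p → ℝ) :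
    restrict B (u - w) = restrict B u - restrict B w := by
  ext j
  by_cases h : j ∈ B <;> simp [restrict, h]

lemma restrict_dotProduct (B : Finset (Fin p)) (u w : Fin p → ℝ) :
    restrict B u ⬝ᵥ w = u ⬝ᵥ restrict B w := by
  refine Finset.sum_congr rfl fun j _ => ?_
  by_cases h : j ∈ B <;> simp [restrict, h]

lemma restrict_dotProduct_restrict (B : Finset (Fin p)) (u w : Fin p → ℝ) :
    restrict B u ⬝ᵥ restrict B w = u ⬝ᵥ restrict B w := by
  refine Finset.sum_congr rfl fun j _ => ?_
  by_cases h : j ∈ B <;> simp [restrict, h]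

end Restrict

/-! ### The prediction seminorm and the eigenvalue conditions. -/

section Design

variable {n p : ℕ} (X : Matrix (Fin n) (Fin p) ℝ)

/-- The prediction seminorm `‖X u‖ / √n`. -/
noncomputable def designNorm (u : Fin p → ℝ) : ℝ := twoNorm (X *ᵥ u) / √(n : ℝ)

lemma designNorm_nonneg (u : Fin p → ℝ) : 0 ≤ designNorm X u :=
  div_nonneg (twoNorm_nonneg _) (Real.sqrt_nonneg _)

lemma sq_designNorm (u : Fin p → ℝ) : designNorm X u ^ 2 = sqNorm (X *ᵥ u) / n := by
  rw [designNorm, div_pow, sq_twoNorm, Real.sq_sqrt (Nat.cast_nonneg _)]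

lemma designNorm_sub_le (u w : Fin p → ℝ) :
    designNorm X (u - w) ≤ designNorm X u + designNorm X w := by
  rw [designNorm, designNorm, designNorm, ← add_div, Matrix.mulVec_sub]
  gcongr
  exact twoNorm_sub_le _ _

lemma dotProduct_sampleCov (u w : Fin p → ℝ) :
    u ⬝ᵥ (sampleCov X *ᵥ w) = (X *ᵥ u ⬝ᵥ X *ᵥ w) / n := by
  rw [sampleCov, Matrix.smul_mulVec, dotProduct_smul, ← Matrix.mulVec_mulVec,
    Matrix.dotProduct_mulVec, Matrix.vecMul_transpose, smul_eq_mul]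
  ring

lemma dotProduct_sampleCov_self (u : Fin p → ℝ) :
    u ⬝ᵥ (sampleCov X *ᵥ u) = designNorm X u ^ 2 := by
  rw [dotProduct_sampleCov, sq_designNorm, dotProduct_self_eq_sqNorm]

/-- Cauchy–Schwarz for the semi-inner product of `S`. Through it a dense vector enters only by its
prediction seminorm, with no eigenvalue bound at its sparsity level. -/
lemma abs_dotProduct_sampleCov_le (u w : Fin p → ℝ) :
    |u ⬝ᵥ (sampleCov X *ᵥ w)| ≤ designNorm X u * designNorm X w := by
  rw [dotProduct_sampleCov, abs_div, Nat.abs_cast, designNorm, designNorm, div_mul_div_comm,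
    Real.mul_self_sqrt (Nat.cast_nonneg _)]
  gcongr
  exact abs_dotProduct_le _ _

lemma rayleigh_eq (u : Fin p → ℝ) :
    sqNorm (X *ᵥ u) / (n * sqNorm u) = designNorm X u ^ 2 / twoNorm u ^ 2 := by
  rw [sq_designNorm, sq_twoNorm, div_div]

variable {X}

lemma RestrictedEigenvalue.le_designNorm {s : ℕ} {k φ : ℝ} (h : RestrictedEigenvalue X s k φ)
    {J : Finset (Fin p)} (hJ : J.card ≤ s) {u : Fin p → ℝ}
    (hu : ∑ j ∈ Jᶜ, |u j| ≤ k * ∑ j ∈ J, |u j|) : φ * twoNorm u ^ 2 ≤ designNorm X u ^ 2 := by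
  rcases eq_or_ne u 0 with rfl | hu0
  · simp [twoNorm_zero, sq_nonneg]
  · have := h J hJ u hu0 hu
    rwa [rayleigh_eq, le_div_iff₀ (pow_pos (twoNorm_pos hu0) 2)] at this

lemma SparseEigenvalue.mono {s t : ℕ} {c C : ℝ} (h : SparseEigenvalue X t c C) (hst : s ≤ t) :
    SparseEigenvalue X s c C := fun ν hν hs => h ν hν (hs.trans hst)

lemma SparseEigenvalue.le_designNorm {s : ℕ} {c C : ℝ} (h : SparseEigenvalue X s c C)
    {u : Fin p → ℝ} (hu : (support u).card ≤ s) : c * twoNorm u ^ 2 ≤ designNorm X u ^ 2 := by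
  rcases eq_or_ne u 0 with rfl | hu0
  · simp [twoNorm_zero, sq_nonneg]
  · have := (h u hu0 hu).1
    rwa [rayleigh_eq, le_div_iff₀ (pow_pos (twoNorm_pos hu0) 2)] at this

lemma designNorm_zero : designNorm X 0 = 0 := by simp [designNorm, twoNorm_zero]

lemma designNorm_le_of_rayleigh_le {C : ℝ} {u : Fin p → ℝ}
    (h : u ≠ 0 → sqNorm (X *ᵥ u) / (n * sqNorm u) ≤ C) : designNorm X u ≤ √C * twoNorm u := by
  rcases eq_or_ne u 0 with rfl | hu0
  · simp [twoNorm_zero, designNorm_zero]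
  · have hpos := twoNorm_pos hu0
    have h1 := h hu0
    rw [rayleigh_eq, ← div_pow] at h1
    rw [← div_le_iff₀ hpos]
    exact Real.le_sqrt_of_sq_le h1

lemma SparseEigenvalue.designNorm_le {s : ℕ} {c C : ℝ} (h : SparseEigenvalue X s c C)
    {u : Fin p → ℝ} (hu : (support u).card ≤ s) : designNorm X u ≤ √C * twoNorm u :=
  designNorm_le_of_rayleigh_le fun hu0 => (h u hu0 hu).2

/-- A Frobenius bound, needed only to see that the set of quotients in `sparseEigMax` is bounded
above, so that its `sSup` really dominates its members. -/
lemma sqNorm_mulVec_le (u : Fin p → ℝ) :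
    sqNorm (X *ᵥ u) ≤ (∑ i, sqNorm (X i)) * sqNorm u := by
  rw [Finset.sum_mul]
  exact Finset.sum_le_sum fun i _ => Finset.sum_mul_sq_le_sq_mul_sq Finset.univ (X i) u

lemma designNorm_le_of_sparseEigMax_le {s : ℕ} {C : ℝ} (h : sparseEigMax X s ≤ C)
    {u : Fin p → ℝ} (hu : (support u).card ≤ s) : designNorm X u ≤ √C * twoNorm u := by
  refine designNorm_le_of_rayleigh_le fun hu0 => le_trans ?_ h
  refine le_csSup ⟨(∑ i, sqNorm (X i)) / n, ?_⟩ ⟨u, hu0, hu, rfl⟩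
  rintro q ⟨w, hw0, -, rfl⟩
  have hw : 0 < sqNorm w := by
    rw [← sq_twoNorm]
    exact pow_pos (twoNorm_pos hw0) 2
  rw [mul_comm, ← div_div]
  gcongr
  rw [div_le_iff₀ hw]
  exact sqNorm_mulVec_le w

end Design

/-! ### The block triangular matrix `L` and the vector `u = (L⁻¹)ᵀ d`. -/

section MoceMatrix

variable {n p : ℕ} {X : Matrix (Fin n) (Fin p) ℝ} {A : Finset (Fin p)} {τa τc : ℝ}

lemma moceL_mulVec_apply (x : Fin p → ℝ) (i : Fin p) :
    (moceL X A τa τc *ᵥ x) i = if i ∈ A then (sampleCov X *ᵥ restrict A x) i + τa * x i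
      else (sampleCov X *ᵥ x) i + τc * x i := by
  have hdiag : ∀ t : ℝ, ∑ j, (if i = j then t else 0) * x j = t * x i := fun t => by
    simp
  by_cases hi : i ∈ A
  · simp only [moceL, mulVec, dotProduct, Matrix.of_apply, add_mul, Finset.sum_add_distrib, hi,
      if_true, hdiag, true_and, restrict]
    congr 1
    refine Finset.sum_congr rfl fun j _ => ?_
    by_cases hj : j ∈ A <;> simp [hj]
  · simp only [moceL, mulVec, dotProduct, Matrix.of_apply, add_mul, Finset.sum_add_distrib, hi,
      if_false, hdiag, false_and]

/-- The deleted block lies in the columns `Aᶜ`, so vectors supported on `A` do not see it. -/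
lemma moceL_mulVec_restrict (x : Fin p → ℝ) :
    moceL X A τa τc *ᵥ restrict A x = sampleCov X *ᵥ restrict A x + τa • restrict A x := by
  ext i
  have hr : restrict A (restrict A x) = restrict A x := by
    ext j; by_cases h : j ∈ A <;> simp [restrict, h]
  rw [moceL_mulVec_apply, hr]
  by_cases hi : i ∈ A <;> simp [hi, restrict]

lemma moceL_mulVec_restrict_compl (x : Fin p → ℝ) :
    moceL X A τa τc *ᵥ restrict Aᶜ x
      = restrict Aᶜ (sampleCov X *ᵥ restrict Aᶜ x) + τc • restrict Aᶜ x := by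
  ext i
  have hr : restrict A (restrict Aᶜ x) = 0 := by
    ext j; by_cases h : j ∈ A <;> simp [restrict, h]
  rw [moceL_mulVec_apply, hr]
  by_cases hi : i ∈ A <;> simp [hi, restrict]

lemma moceL_mulVec_sub (x : Fin p → ℝ) :
    moceL X A τa τc *ᵥ x - sampleCov X *ᵥ x = τa • restrict A x
      - restrict A (sampleCov X *ᵥ restrict Aᶜ x) + τc • restrict Aᶜ x := by
  ext i
  have hx : sampleCov X *ᵥ x
      = sampleCov X *ᵥ restrict A x + sampleCov X *ᵥ restrict Aᶜ x := by
    rw [← Matrix.mulVec_add, restrict_add_restrict_compl]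
  rw [Pi.sub_apply, moceL_mulVec_apply]
  by_cases hi : i ∈ A
  · have := congrFun hx i
    simp only [Pi.add_apply] at this
    simp only [hi, if_true, this, Pi.add_apply, Pi.sub_apply, Pi.smul_apply, restrict,
      Finset.mem_compl, not_true_eq_false, if_false, smul_eq_mul, mul_zero, add_zero]
    ring
  · simp [hi, restrict]

/-- Forward substitution for a kernel vector `x`: the rows in `A` involve only `x` on `A`, which
vanishes because `S + τa I` is positive definite; the remaining rows then kill `x` by the same
argument with `τc`. -/
lemma isUnit_moceL_det (hτa : 0 < τa) (hτc : 0 < τc) : IsUnit (moceL X A τa τc).det := by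
  rw [isUnit_iff_ne_zero, Ne, ← Matrix.exists_mulVec_eq_zero_iff]
  rintro ⟨x, hx0, hx⟩
  have hL := fun i => moceL_mulVec_apply (X := X) (A := A) (τa := τa) (τc := τc) x i
  simp only [hx, Pi.zero_apply] at hL
  have hzero : ∀ (τ : ℝ) (u : Fin p → ℝ), 0 < τ →
      u ⬝ᵥ (sampleCov X *ᵥ u + τ • u) = 0 → u = 0 := by
    intro τ u hτ h
    rw [dotProduct_add, dotProduct_smul, dotProduct_sampleCov_self, dotProduct_self_eq_sqNorm,
      ← sq_twoNorm, smul_eq_mul] at h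
    by_contra hu
    have := mul_pos hτ (pow_pos (twoNorm_pos hu) 2)
    nlinarith [sq_nonneg (designNorm X u)]
  have hA : restrict A x = 0 := by
    refine hzero τa _ hτa (Finset.sum_eq_zero fun i _ => ?_)
    by_cases hi : i ∈ A
    · have := hL i
      simp only [hi, if_true] at this
      simp [restrict, hi] at this ⊢
      exact Or.inr this.symm
    · simp [restrict, hi]
  refine hx0 (hzero τc x hτc (Finset.sum_eq_zero fun i _ => ?_))
  by_cases hi : i ∈ A
  · have := congrFun hA i
    simp only [restrict, hi, if_true, Pi.zero_apply] at this
    simp [this]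
  · have := hL i
    simp only [hi, if_false] at this
    simp [← this]

variable {u d : Fin p → ℝ}

/-- Testing `hu` with `w`, the restriction of `u` to `Aᶜ`, gives the energy identity `designNorm X w
^ 2 + τc ‖w‖² = d·w ≤ ‖w‖`. Both bounds follow, whatever the sparsity of `w`. -/
lemma twoNorm_restrict_compl_le (hτc : 0 < τc) (hd : twoNorm d = 1)
    (hu : ∀ z, u ⬝ᵥ (moceL X A τa τc *ᵥ z) = d ⬝ᵥ z) :
    τc * twoNorm (restrict Aᶜ u) ≤ 1 ∧ designNorm X (restrict Aᶜ u) ^ 2 ≤ 1 / τc := by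
  set w := restrict Aᶜ u with hw
  have h := hu w
  rw [hw, moceL_mulVec_restrict_compl, dotProduct_add, ← restrict_dotProduct, ← hw,
    dotProduct_sampleCov_self, dotProduct_smul, hw, ← restrict_dotProduct_restrict, ← hw,
    dotProduct_self_eq_sqNorm, ← sq_twoNorm, smul_eq_mul] at h
  have h1 := dotProduct_le d w
  rw [hd, one_mul] at h1
  have h2 : τc * twoNorm w ≤ 1 := by
    by_contra! hlt
    have : 0 < twoNorm w := by
      by_contra! h0
      nlinarith
    nlinarith [sq_nonneg (designNorm X w)]
  refine ⟨h2, ?_⟩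
  rw [le_div_iff₀ hτc]
  have := mul_nonneg hτc.le (sq_nonneg (twoNorm w))
  nlinarith

/-- Now `hu` is tested with `u` restricted to `A`. The lower sparse eigenvalue makes the quadratic
term coercive; the cross term with `u` on `Aᶜ` is absorbed by Cauchy–Schwarz and the energy bound
there. -/
lemma twoNorm_restrict_le_of_sparse {c C : ℝ} (hc : 0 < c)
    (hSE : SparseEigenvalue X A.card c C) (hτa : 0 < τa) (hτc : 0 < τc) (hd : twoNorm d = 1)
    (hu : ∀ z, u ⬝ᵥ (moceL X A τa τc *ᵥ z) = d ⬝ᵥ z) :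
    twoNorm (restrict A u) ≤ (1 + √C * √(1 / τc)) / c := by
  set w := restrict A u with hw
  have h := hu w
  have hsplit : u ⬝ᵥ (sampleCov X *ᵥ w)
      = w ⬝ᵥ (sampleCov X *ᵥ w) + restrict Aᶜ u ⬝ᵥ (sampleCov X *ᵥ w) := by
    rw [← add_dotProduct, hw, restrict_add_restrict_compl]
  rw [hw, moceL_mulVec_restrict, dotProduct_add, ← hw, hsplit,
    dotProduct_sampleCov_self, dotProduct_smul, hw, ← restrict_dotProduct_restrict, ← hw,
    dotProduct_self_eq_sqNorm, ← sq_twoNorm, smul_eq_mul] at h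
  have h1 := dotProduct_le d w
  rw [hd, one_mul] at h1
  have hcard := card_support_restrict_le A u
  rw [← hw] at hcard
  have h2 := hSE.le_designNorm hcard
  have h3 := hSE.designNorm_le hcard
  have h4 := abs_dotProduct_sampleCov_le X (restrict Aᶜ u) w
  have h5 : designNorm X (restrict Aᶜ u) ≤ √(1 / τc) :=
    Real.le_sqrt_of_sq_le (twoNorm_restrict_compl_le hτc hd hu).2
  have h6 : designNorm X (restrict Aᶜ u) * designNorm X w ≤ √(1 / τc) * (√C * twoNorm w) :=
    mul_le_mul h5 h3 (designNorm_nonneg X w) (Real.sqrt_nonneg _)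
  have h7 := neg_le_of_abs_le (h4.trans h6)
  have h8 : c * twoNorm w ^ 2 ≤ (1 + √C * √(1 / τc)) * twoNorm w := by
    have := mul_nonneg hτa.le (sq_nonneg (twoNorm w))
    linarith
  rcases (twoNorm_nonneg w).eq_or_lt with h0 | h0
  · rw [← h0]; positivity
  · rw [le_div_iff₀ hc]
    refine le_of_mul_le_mul_right ?_ h0
    linarith

lemma abs_remainder_le {c C t : ℝ} (hc : 0 < c)
    (hSE : SparseEigenvalue X A.card c C) (hτa : 0 < τa) (ht : 0 < t) (hτc : t ≤ τc)
    (hd : twoNorm d = 1) (hu : ∀ z, u ⬝ᵥ (moceL X A τa τc *ᵥ z) = d ⬝ᵥ z) (x : Fin p → ℝ) :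
    |u ⬝ᵥ (moceL X A τa τc *ᵥ x - sampleCov X *ᵥ x)|
      ≤ (1 + √C * √(1 / t)) / c * (τa * twoNorm x + √C * designNorm X (restrict Aᶜ x))
        + twoNorm (restrict Aᶜ x) := by
  have hτc0 : 0 < τc := ht.trans_le hτc
  set B := (1 + √C * √(1 / t)) / c with hB
  have hB0 : 0 ≤ B := by positivity
  have huA : twoNorm (restrict A u) ≤ B := by
    refine (twoNorm_restrict_le_of_sparse hc hSE hτa hτc0 hd hu).trans ?_
    rw [hB]
    gcongr
  have hcard := card_support_restrict_le A u
  have h1 : |u ⬝ᵥ restrict A x| ≤ B * twoNorm x := by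
    rw [← restrict_dotProduct]
    refine (abs_dotProduct_le _ _).trans ?_
    exact mul_le_mul_of_nonneg_right huA (twoNorm_nonneg x)
  have h2 : |u ⬝ᵥ restrict A (sampleCov X *ᵥ restrict Aᶜ x)|
      ≤ B * (√C * designNorm X (restrict Aᶜ x)) := by
    rw [← restrict_dotProduct]
    refine (abs_dotProduct_sampleCov_le X _ _).trans ?_
    calc _ ≤ √C * twoNorm (restrict A u) * designNorm X (restrict Aᶜ x) :=
          mul_le_mul_of_nonneg_right (hSE.designNorm_le hcard) (designNorm_nonneg X _)
      _ ≤ √C * B * designNorm X (restrict Aᶜ x) :=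
          mul_le_mul_of_nonneg_right (mul_le_mul_of_nonneg_left huA (Real.sqrt_nonneg _))
            (designNorm_nonneg X _)
      _ = _ := by ring
  -- The factor `τc` cancels against the bound `1 / τc` for `u` on `Aᶜ`, so a large `τc` does no
  -- harm.
  have h3 : τc * |u ⬝ᵥ restrict Aᶜ x| ≤ twoNorm (restrict Aᶜ x) := by
    rw [← restrict_dotProduct_restrict]
    calc _ ≤ τc * (twoNorm (restrict Aᶜ u) * twoNorm (restrict Aᶜ x)) :=
          mul_le_mul_of_nonneg_left (abs_dotProduct_le _ _) hτc0.le
      _ = τc * twoNorm (restrict Aᶜ u) * twoNorm (restrict Aᶜ x) := by ring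
      _ ≤ 1 * twoNorm (restrict Aᶜ x) :=
          mul_le_mul_of_nonneg_right (twoNorm_restrict_compl_le hτc0 hd hu).1 (twoNorm_nonneg _)
      _ = _ := one_mul _
  rw [moceL_mulVec_sub, dotProduct_add, dotProduct_sub, dotProduct_smul, dotProduct_smul,
    smul_eq_mul, smul_eq_mul]
  calc _ ≤ |τa * u ⬝ᵥ restrict A x - u ⬝ᵥ restrict A (sampleCov X *ᵥ restrict Aᶜ x)|
        + |τc * u ⬝ᵥ restrict Aᶜ x| := abs_add_le _ _
    _ ≤ |τa * u ⬝ᵥ restrict A x| + |u ⬝ᵥ restrict A (sampleCov X *ᵥ restrict Aᶜ x)|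
        + |τc * u ⬝ᵥ restrict Aᶜ x| := by gcongr; exact abs_sub _ _
    _ = τa * |u ⬝ᵥ restrict A x| + |u ⬝ᵥ restrict A (sampleCov X *ᵥ restrict Aᶜ x)|
        + τc * |u ⬝ᵥ restrict Aᶜ x| := by
        rw [abs_mul, abs_mul, abs_of_pos hτa, abs_of_pos hτc0]
    _ ≤ τa * (B * twoNorm x) + B * (√C * designNorm X (restrict Aᶜ x))
        + twoNorm (restrict Aᶜ x) := by gcongr
    _ = _ := by ring

end MoceMatrix

/-! ### A crude error bound for the LASSO. -/

section Lasso

variable {n p : ℕ} {X : Matrix (Fin n) (Fin p) ℝ}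

lemma sum_abs_sub_sum_abs_le (β b : Fin p → ℝ) :
    ∑ j, |β j| - ∑ j, |b j|
      ≤ ∑ j ∈ support β, |(b - β) j| - ∑ j ∈ (support β)ᶜ, |(b - β) j| := by
  rw [← Finset.sum_sub_distrib, ← Finset.sum_add_sum_compl (support β), sub_eq_add_neg,
    ← Finset.sum_neg_distrib]
  refine add_le_add (Finset.sum_le_sum fun j _ => ?_) (Finset.sum_le_sum fun j hj => ?_)
  · rw [Pi.sub_apply, abs_sub_comm]
    exact abs_sub_abs_le_abs_sub _ _
  · have : β j = 0 := by simpa [support] using hj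
    simp [this]

/-- A bound for the estimation error of the LASSO that needs no condition linking the tuning
parameter with the noise. -/
lemma IsLasso.mul_twoNorm_sub_le (hn : 0 < n) {lam φ : ℝ} (hlam : 0 < lam) (hφ : 0 < φ)
    {β b : Fin p → ℝ} {e : Fin n → ℝ} (hRE : RestrictedEigenvalue X (support β).card 3 φ)
    (hb : IsLasso X (X *ᵥ β + e) lam b) (hsmall : lam * √((support β).card : ℝ) ≤ 1) :
    lam * twoNorm (b - β) ≤ (1 + 2 / √φ + 2 / φ) * (1 + sqNorm e / n) := by
  have hn' : (0 : ℝ) < n := by exact_mod_cast hn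
  set Δ := b - β with hΔ
  set J := support β with hJ
  set Q := sqNorm e / n with hQ
  have hQ0 : 0 ≤ Q := div_nonneg (sqNorm_nonneg e) hn'.le
  have hobj := hb β
  have hres : X *ᵥ β + e - X *ᵥ b = e - X *ᵥ Δ := by
    rw [hΔ, Matrix.mulVec_sub]; abel
  have hres' : X *ᵥ β + e - X *ᵥ β = e := by abel
  rw [lassoObjective, lassoObjective, hres, hres'] at hobj
  have hl1 := mul_le_mul_of_nonneg_left (sum_abs_sub_sum_abs_le β b) hlam.le
  rw [← hΔ, ← hJ] at hl1
  set P := ∑ j ∈ J, |Δ j| with hP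
  set P' := ∑ j ∈ Jᶜ, |Δ j| with hP'
  have hP0 : 0 ≤ P := Finset.sum_nonneg fun _ _ => abs_nonneg _
  have hP0' : 0 ≤ P' := Finset.sum_nonneg fun _ _ => abs_nonneg _
  have hQe : 1 / (2 * (n : ℝ)) * sqNorm e = Q / 2 := by rw [hQ]; field_simp
  have hcoef : 1 ≤ 1 + 2 / √φ + 2 / φ := by
    have : 0 ≤ 2 / √φ := by positivity
    have : 0 ≤ 2 / φ := by positivity
    linarith
  -- The basic inequality with the residual of `b` dropped: the whole noise energy takes the place
  -- of a bound on `Xᵀ e`.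
  have hdev : lam * P' ≤ lam * P + Q / 2 := by
    have : 0 ≤ 1 / (2 * (n : ℝ)) * sqNorm (e - X *ᵥ Δ) :=
      mul_nonneg (by positivity) (sqNorm_nonneg _)
    nlinarith
  -- If the noise energy is small against `lam * P`, then `Δ` lies in the cone with constant 3.
  -- Otherwise `lam * (P + P')` is already below `Q`.
  rcases le_or_gt (Q / 2) (2 * (lam * P)) with hcase | hcase
  · have hcone : P' ≤ 3 * P := by
      refine le_of_mul_le_mul_left ?_ hlam
      linarith
    have hre := hRE.le_designNorm le_rfl hcone
    set D := designNorm X Δ with hD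
    have hD0 : 0 ≤ D := designNorm_nonneg X Δ
    have hN : twoNorm Δ ≤ D / √φ := by
      rw [le_div_iff₀ (Real.sqrt_pos.2 hφ)]
      refine le_of_sq_le_sq ?_ hD0
      rw [mul_pow, Real.sq_sqrt hφ.le]
      linarith
    have hPN := sum_abs_le_sqrt_card_mul J Δ
    -- The empty support is separate: `hsmall` yields `lam ≤ 1` only when `J` is nonempty, but for
    -- empty `J` the cone condition forces `Δ = 0`.
    rcases Nat.eq_zero_or_pos J.card with ha | ha
    · have hPz : P = 0 := by
        rw [ha] at hPN
        simp only [Nat.cast_zero, Real.sqrt_zero, zero_mul] at hPN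
        exact le_antisymm hPN hP0
      have hall : twoNorm Δ ≤ 0 := by
        refine (twoNorm_le_sum_abs Δ).trans ?_
        rw [← Finset.sum_add_sum_compl J]
        linarith
      have : lam * twoNorm Δ ≤ 0 := by nlinarith
      exact this.trans (by positivity)
    · have ha1 : 1 ≤ √(J.card : ℝ) := by
        rw [Real.one_le_sqrt]
        exact_mod_cast ha
      have hlam1 : lam ≤ 1 := by nlinarith
      have hexpand : 1 / (2 * (n : ℝ)) * sqNorm (e - X *ᵥ Δ)
          = Q / 2 - (e ⬝ᵥ X *ᵥ Δ) / n + D ^ 2 / 2 := by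
        rw [hD, sq_designNorm, hQ, ← dotProduct_self_eq_sqNorm, sub_dotProduct, dotProduct_sub,
          dotProduct_sub, dotProduct_self_eq_sqNorm, dotProduct_self_eq_sqNorm,
          dotProduct_comm (X *ᵥ Δ) e]
        field_simp
        ring
      have hcross : (e ⬝ᵥ X *ᵥ Δ) / n ≤ √Q * D := by
        rw [hQ, hD, designNorm, Real.sqrt_div (sqNorm_nonneg e), div_mul_div_comm,
          Real.mul_self_sqrt hn'.le]
        gcongr
        exact dotProduct_le _ _
      -- In the cone the residual is expanded: the noise term costs `√Q * D`, and the penalty costs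
      -- `D / √φ` by the restricted eigenvalue and `hsmall`.
      have hmain : D ^ 2 / 2 ≤ (√Q + 1 / √φ) * D := by
        have h1 : lam * P ≤ D / √φ := by
          calc lam * P ≤ lam * (√(J.card : ℝ) * twoNorm Δ) := by gcongr
            _ = lam * √(J.card : ℝ) * twoNorm Δ := by ring
            _ ≤ 1 * twoNorm Δ := mul_le_mul_of_nonneg_right hsmall (twoNorm_nonneg _)
            _ ≤ D / √φ := by rwa [one_mul]
        have h2 := mul_nonneg hlam.le hP0'
        rw [hexpand, hQe] at hobj
        have : (√Q + 1 / √φ) * D = √Q * D + D / √φ := by ring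
        linarith
      have hDle : D ≤ 2 * (√Q + 1 / √φ) := by
        rcases hD0.eq_or_lt with h0 | h0
        · rw [← h0]; positivity
        · refine le_of_mul_le_mul_right ?_ h0
          linarith
      have hsq : √Q ≤ 1 + Q := by
        refine Real.sqrt_le_iff.2 ⟨by linarith, by nlinarith⟩
      calc lam * twoNorm Δ ≤ 1 * (D / √φ) :=
            mul_le_mul hlam1 hN (twoNorm_nonneg _) zero_le_one
        _ ≤ 1 * (2 * ((1 + Q) + 1 / √φ) / √φ) := by
            gcongr
            linarith
        _ = 2 / √φ * (1 + Q) + 2 / (√φ * √φ) := by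
            field_simp
        _ = 2 / √φ * (1 + Q) + 2 / φ := by rw [Real.mul_self_sqrt hφ.le]
        _ ≤ _ := by
            have : 0 ≤ 2 / φ * Q := by positivity
            nlinarith
  · have h1 : twoNorm Δ ≤ P + P' := by
      refine (twoNorm_le_sum_abs Δ).trans ?_
      rw [← Finset.sum_add_sum_compl J]
    have h2 := mul_le_mul_of_nonneg_left h1 hlam.le
    have h3 : lam * twoNorm Δ ≤ 1 + Q := by linarith
    exact h3.trans (le_mul_of_one_le_left (by linarith) hcoef)

end Lasso

/-! ### Expansion of the estimator and deterministic bound for the remainder. -/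

section Decomposition

variable {n p : ℕ} {X : Matrix (Fin n) (Fin p) ℝ} {A : Finset (Fin p)} {τa τc : ℝ}

lemma dotProduct_inv_mulVec (M : Matrix (Fin p) (Fin p) ℝ) (d z : Fin p → ℝ) :
    d ⬝ᵥ (M⁻¹ *ᵥ z) = ((M⁻¹)ᵀ *ᵥ d) ⬝ᵥ z := by
  rw [Matrix.dotProduct_mulVec, Matrix.mulVec_transpose]

lemma transpose_inv_mulVec_dotProduct {M : Matrix (Fin p) (Fin p) ℝ} (hM : IsUnit M.det)
    (d z : Fin p → ℝ) : ((M⁻¹)ᵀ *ᵥ d) ⬝ᵥ (M *ᵥ z) = d ⬝ᵥ z := by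
  rw [← dotProduct_inv_mulVec, Matrix.mulVec_mulVec, Matrix.nonsing_inv_mul _ hM,
    Matrix.one_mulVec]

/-- The definition of `κ` makes `lam κ` equal to `Xᵀ e / n - S (b - β)`. Moving `L⁻¹` onto `d` and
writing `d·(b - β)` as `u·L(b - β)` leaves only `L - S`. -/
lemma studentized_sub_leadingTerm {lam : ℝ} (hlam : lam ≠ 0)
    (hL : IsUnit (moceL X A τa τc).det) (v : ℝ) (d β b : Fin p → ℝ) (e : Fin n → ℝ) :
    studentized n v d (moceEstimator X (X *ᵥ β + e) lam A τa τc b) β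
        - leadingTerm X A τa τc v d e
      = √(n : ℝ) * v⁻¹ * ((((moceL X A τa τc)⁻¹)ᵀ *ᵥ d) ⬝ᵥ
          (moceL X A τa τc *ᵥ (b - β) - sampleCov X *ᵥ (b - β))) := by
  set u := ((moceL X A τa τc)⁻¹)ᵀ *ᵥ d with hu
  have hκ : lam • lassoKappa X (X *ᵥ β + e) lam b
      = (1 / (n : ℝ)) • (Xᵀ *ᵥ e) - sampleCov X *ᵥ (b - β) := by
    have : X *ᵥ β + e - X *ᵥ b = e - X *ᵥ (b - β) := by
      rw [Matrix.mulVec_sub]; abel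
    rw [lassoKappa, smul_smul, mul_inv_cancel₀ hlam, one_smul, this, sampleCov,
      Matrix.mulVec_sub, smul_sub, Matrix.mulVec_mulVec, Matrix.smul_mulVec]
  have hest : moceEstimator X (X *ᵥ β + e) lam A τa τc b - β
      = (b - β) + (moceL X A τa τc)⁻¹ *ᵥ
        ((1 / (n : ℝ)) • (Xᵀ *ᵥ e) - sampleCov X *ᵥ (b - β)) := by
    rw [← hκ, moceEstimator, Matrix.mulVec_smul]; abel
  have hkey : u ⬝ᵥ (moceL X A τa τc *ᵥ (b - β)) = d ⬝ᵥ (b - β) :=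
    transpose_inv_mulVec_dotProduct hL d _
  have hsqrt : √(n : ℝ) * (1 / (n : ℝ)) = 1 / √(n : ℝ) := by
    rw [mul_one_div, Real.sqrt_div_self']
  rw [studentized, leadingTerm, hest, dotProduct_add, dotProduct_inv_mulVec,
    dotProduct_inv_mulVec, ← hu, dotProduct_sub u, dotProduct_smul, dotProduct_sub u, hkey,
    ← hsqrt, smul_eq_mul]
  ring

lemma moceWeight_eq (d : Fin p → ℝ) (i : Fin n) :
    moceWeight X A τa τc d i
      = 1 / √(n : ℝ) * (X *ᵥ (((moceL X A τa τc)⁻¹)ᵀ *ᵥ d)) i := by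
  rw [moceWeight, dotProduct_inv_mulVec, dotProduct_comm]
  rfl

lemma leadingTerm_eq_sum (v : ℝ) (d : Fin p → ℝ) (e : Fin n → ℝ) :
    leadingTerm X A τa τc v d e = ∑ i, v⁻¹ * moceWeight X A τa τc d i * e i := by
  rw [leadingTerm, dotProduct_inv_mulVec, Matrix.dotProduct_mulVec, Matrix.vecMul_transpose,
    dotProduct, Finset.mul_sum]
  refine Finset.sum_congr rfl fun i _ => ?_
  rw [moceWeight_eq]
  ring

/-- This makes `v⁻¹` the exact normalization of the weighted sum, not merely an asymptotic one. -/
lemma moceVar_eq_sum (σ : ℝ) (d : Fin p → ℝ) :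
    moceVar X A τa τc σ d = σ ^ 2 * ∑ i, moceWeight X A τa τc d i ^ 2 := by
  have : d ⬝ᵥ (((moceL X A τa τc)⁻¹ * sampleCov X * ((moceL X A τa τc)⁻¹)ᵀ) *ᵥ d)
      = designNorm X (((moceL X A τa τc)⁻¹)ᵀ *ᵥ d) ^ 2 := by
    rw [← dotProduct_sampleCov_self, ← Matrix.mulVec_mulVec, ← Matrix.mulVec_mulVec,
      dotProduct_inv_mulVec]
  rw [moceVar, this, sq_designNorm]
  simp only [moceWeight_eq, mul_pow, ← Finset.mul_sum]
  rw [div_pow, one_pow, Real.sq_sqrt (Nat.cast_nonneg _), sqNorm]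
  ring

/-- The last factor collects the three sources of error: the ridge `τa` acting on the LASSO error,
the leakage of `b` outside `A`, and the missed signals. The constant in front does not depend on
`n`. -/
lemma mul_abs_remainder_le {lam φ c C C' t v₀ v : ℝ} (hn : 0 < n) (hlam : 0 < lam) (hφ : 0 < φ)
    (hc : 0 < c) (ht : 0 < t) (hv₀ : 0 < v₀) (hv : v₀ ≤ v)
    {β b d : Fin p → ℝ} {e : Fin n → ℝ} (hd : twoNorm d = 1)
    (hRE : RestrictedEigenvalue X (support β).card 3 φ)
    (hb : IsLasso X (X *ᵥ β + e) lam b) (hsmall : lam * √((support β).card : ℝ) ≤ 1)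
    (hSE : SparseEigenvalue X (max A.card (support b).card) c C)
    (hfn : sparseEigMax X (support β ∩ Aᶜ).card ≤ C') (hτa : 0 < τa) (hτc : t ≤ τc) :
    |studentized n v d (moceEstimator X (X *ᵥ β + e) lam A τa τc b) β
        - leadingTerm X A τa τc v d e|
      ≤ v₀⁻¹ * ((1 + √C * √(1 / t)) / c * (1 + 2 / √φ + 2 / φ)
            + ((1 + √C * √(1 / t)) / c * (√C * √C) + 1)
            + ((1 + √C * √(1 / t)) / c * (√C * √C') + 1))
        * (√(n : ℝ) * τa / lam * (1 + sqNorm e / n)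
          + √(n : ℝ) * (√((support b).card : ℝ) * ‖restrict (Aᶜ ∩ support b) b‖)
          + √(n : ℝ) * twoNorm (restrict Aᶜ β)) := by
  have hL : IsUnit (moceL X A τa τc).det := isUnit_moceL_det hτa (ht.trans_le hτc)
  have hrem := abs_remainder_le hc (hSE.mono (le_max_left _ _)) hτa ht hτc hd
    (transpose_inv_mulVec_dotProduct hL d) (b - β)
  have hlasso := hb.mul_twoNorm_sub_le hn hlam hφ hRE hsmall
  rw [studentized_sub_leadingTerm hlam.ne' hL, abs_mul, abs_mul,
    abs_of_nonneg (Real.sqrt_nonneg _), abs_inv, abs_of_pos (hv₀.trans_le hv)]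
  set R := |(((moceL X A τa τc)⁻¹)ᵀ *ᵥ d) ⬝ᵥ
          (moceL X A τa τc *ᵥ (b - β) - sampleCov X *ᵥ (b - β))|
  set B := (1 + √C * √(1 / t)) / c
  set K := 1 + 2 / √φ + 2 / φ
  have hB0 : 0 ≤ B := by positivity
  have hK0 : 0 ≤ K := by positivity
  set l := √((support b).card : ℝ) * ‖restrict (Aᶜ ∩ support b) b‖
  have hl0 : 0 ≤ l := by positivity
  have hbl : twoNorm (restrict Aᶜ b) ≤ l := by
    have heq : restrict Aᶜ b = restrict (Aᶜ ∩ support b) b := by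
      ext j
      by_cases h : b j = 0 <;> simp [restrict, support, h]
    rw [heq]
    refine twoNorm_le_sqrt_card_mul (norm_nonneg _) (fun j hj => ?_) fun j => ?_
    · simp [restrict, hj]
    · rw [← Real.norm_eq_abs]
      exact norm_le_pi_norm _ j
  have hD : designNorm X (restrict Aᶜ (b - β)) ≤ √C * l + √C' * twoNorm (restrict Aᶜ β) := by
    rw [restrict_sub]
    refine (designNorm_sub_le X _ _).trans (add_le_add ?_ ?_)
    -- The two parts are kept separate because `b` on `Aᶜ` has at most `â` nonzero entries, while
    -- `β` on `Aᶜ` is supported on the missed signals; each has its own eigenvalue bound.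
    · refine ((hSE.mono (le_max_right _ _)).designNorm_le (u := restrict Aᶜ b) ?_).trans ?_
      · rw [support_restrict]
        exact Finset.card_le_card Finset.inter_subset_left
      · gcongr
    · refine designNorm_le_of_sparseEigMax_le hfn ?_
      rw [support_restrict]
  have hΔc : twoNorm (restrict Aᶜ (b - β)) ≤ l + twoNorm (restrict Aᶜ β) := by
    rw [restrict_sub]
    exact (twoNorm_sub_le _ _).trans (by gcongr)
  set η := twoNorm (restrict Aᶜ β)
  have hη0 : 0 ≤ η := twoNorm_nonneg _
  set Q := 1 + sqNorm e / n
  have hQ0 : 0 ≤ Q := by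
    have := div_nonneg (sqNorm_nonneg e) (Nat.cast_nonneg (α := ℝ) n)
    linarith
  have hR : R ≤ B * K * (τa / lam * Q) + (B * (√C * √C) + 1) * l
      + (B * (√C * √C') + 1) * η := by
    have h1 : τa * twoNorm (b - β) ≤ τa / lam * (K * Q) := by
      rw [div_mul_eq_mul_div, le_div_iff₀ hlam]
      nlinarith
    calc R ≤ B * (τa / lam * (K * Q) + √C * (√C * l + √C' * η)) + (l + η) := by
          refine hrem.trans ?_
          gcongr
      _ = _ := by ring
  have hx : 0 ≤ √(n : ℝ) * τa / lam * Q := by positivity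
  have hy : 0 ≤ √(n : ℝ) * l := by positivity
  have hz : 0 ≤ √(n : ℝ) * η := by positivity
  have hk1 : 0 ≤ B * K := by positivity
  have hk2 : 0 ≤ B * (√C * √C) + 1 := by positivity
  have hk3 : 0 ≤ B * (√C * √C') + 1 := by positivity
  calc √(n : ℝ) * v⁻¹ * R ≤ √(n : ℝ) * v₀⁻¹ * (B * K * (τa / lam * Q)
        + (B * (√C * √C) + 1) * l + (B * (√C * √C') + 1) * η) := by gcongr
    _ = v₀⁻¹ * (B * K * (√(n : ℝ) * τa / lam * Q) + (B * (√C * √C) + 1) * (√(n : ℝ) * l)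
        + (B * (√C * √C') + 1) * (√(n : ℝ) * η)) := by ring
    _ ≤ v₀⁻¹ * ((B * K + (B * (√C * √C) + 1) + (B * (√C * √C') + 1))
        * (√(n : ℝ) * τa / lam * Q + √(n : ℝ) * l + √(n : ℝ) * η)) := by
        gcongr
        nlinarith [mul_nonneg hk1 hy, mul_nonneg hk1 hz, mul_nonneg hk2 hx, mul_nonneg hk2 hz,
          mul_nonneg hk3 hx, mul_nonneg hk3 hy]
    _ = _ := by ring

/-- Missed signals are split at the threshold. There are at most `(support β).card` weak ones, each
at most `σ √(2 log p) / n`, which gives the second summand. -/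
lemma twoNorm_restrict_compl_le_add {σ : ℝ} (hσ : 0 ≤ σ) (β : Fin p → ℝ) :
    √(n : ℝ) * twoNorm (restrict Aᶜ β)
      ≤ twoNorm (restrict (Aᶜ ∩ signalSet n σ β) β) * √(n : ℝ)
        + √2 * σ * (√(Real.log p / n) * √((support β).card : ℝ)) := by
  have hsplit : restrict Aᶜ β
      = restrict (Aᶜ ∩ signalSet n σ β) β + restrict (Aᶜ \ signalSet n σ β) β := by
    ext j
    by_cases h1 : j ∈ A <;> by_cases h2 : j ∈ signalSet n σ β <;> simp [restrict, h1, h2]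
  have hlog : 0 ≤ Real.log p := Real.log_natCast_nonneg p
  have hweak : twoNorm (restrict (Aᶜ \ signalSet n σ β) β)
      ≤ √((support β).card : ℝ) * (√(2 * Real.log p) / n * σ) := by
    refine twoNorm_le_sqrt_card_mul (by positivity) (fun j hj => ?_) fun j => ?_
    · have : β j = 0 := by simpa [support] using hj
      simp [restrict, this]
    · by_cases hj : j ∈ Aᶜ \ signalSet n σ β
      · have := (Finset.mem_sdiff.1 hj).2
        rw [restrict, if_pos hj]
        simpa [signalSet] using this
      · rw [restrict, if_neg hj, abs_zero]
        positivity
  have hsqrt : √(n : ℝ) * (√(2 * Real.log p) / n * σ) = √2 * σ * √(Real.log p / n) := by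
    rw [Real.sqrt_mul zero_le_two, Real.sqrt_div hlog]
    have : √(n : ℝ) / n = 1 / √(n : ℝ) := Real.sqrt_div_self'
    calc _ = √2 * √(Real.log p) * σ * (√(n : ℝ) / n) := by ring
      _ = _ := by rw [this]; ring
  calc √(n : ℝ) * twoNorm (restrict Aᶜ β)
      ≤ √(n : ℝ) * (twoNorm (restrict (Aᶜ ∩ signalSet n σ β) β)
        + √((support β).card : ℝ) * (√(2 * Real.log p) / n * σ)) := by
        rw [hsplit]
        gcongr
        exact (twoNorm_add_le _ _).trans (by gcongr)
    _ = twoNorm (restrict (Aᶜ ∩ signalSet n σ β) β) * √(n : ℝ)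
        + √(n : ℝ) * (√(2 * Real.log p) / n * σ) * √((support β).card : ℝ) := by ring
    _ = _ := by rw [hsqrt]; ring

end Decomposition

/-! ### Measurability and convergence in probability. -/

section Probability

variable {Ω : Type*} [MeasurableSpace Ω] {μ : Measure Ω}

lemma measurable_mulVec {k l : ℕ} (M : Matrix (Fin k) (Fin l) ℝ) {f : Ω → Fin l → ℝ}
    (hf : Measurable f) : Measurable fun ω => M *ᵥ f ω :=
  measurable_pi_iff.2 fun i => Finset.measurable_sum Finset.univ fun j _ =>
    (measurable_pi_iff.1 hf j).const_mul (M i j)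

lemma measurable_dotProduct {l : ℕ} (d : Fin l → ℝ) {f : Ω → Fin l → ℝ}
    (hf : Measurable f) : Measurable fun ω => d ⬝ᵥ f ω :=
  Finset.measurable_sum _ fun j _ => (measurable_pi_iff.1 hf j).const_mul _

lemma measurable_card_support {p : ℕ} {b : Ω → Fin p → ℝ} (hb : Measurable b) :
    Measurable fun ω => (support (b ω)).card := by
  simp only [support, Finset.card_filter]
  refine Finset.measurable_sum _ fun j _ => Measurable.ite ?_ measurable_const measurable_const
  exact (measurable_pi_iff.1 hb j) (measurableSet_singleton (0 : ℝ)).compl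

lemma measurable_studentized {n p : ℕ} (X : Matrix (Fin n) (Fin p) ℝ) (lam : ℝ)
    (A : Finset (Fin p)) (τa τc v : ℝ) (d β : Fin p → ℝ) {y : Ω → Fin n → ℝ}
    {b : Ω → Fin p → ℝ} (hy : Measurable y) (hb : Measurable b) :
    Measurable fun ω => studentized n v d (moceEstimator X (y ω) lam A τa τc (b ω)) β := by
  refine (measurable_dotProduct d (Measurable.sub ?_ measurable_const)).const_mul _
  refine hb.add (Measurable.const_smul (measurable_mulVec _ ?_) lam)
  have hres : Measurable fun ω => Xᵀ *ᵥ (y ω - X *ᵥ b ω) :=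
    measurable_mulVec _ (hy.sub (measurable_mulVec _ hb))
  exact (hres.const_smul (1 / (n : ℝ))).const_smul lam⁻¹

/-- A union bound: once `η n < δ / (3 * K)`, the event `|f n| ≥ δ` forces `|q n|` or `|l n|` to
reach `δ / (3 * K)`, or `E n` to fail. -/
lemma tendstoInMeasure_zero_of_abs_le {f q l : ℕ → Ω → ℝ} {η : ℕ → ℝ} {E : ℕ → Set Ω} {K : ℝ}
    (hK : 0 < K) (hq : TendstoInMeasure μ q atTop 0) (hl : TendstoInMeasure μ l atTop 0)
    (hη : Tendsto η atTop (𝓝 0)) (hE : Tendsto (fun n => μ (E n)ᶜ) atTop (𝓝 0))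
    (h : ∀ᶠ n in atTop, ∀ᵐ ω ∂μ, ω ∈ E n → |f n ω| ≤ K * (q n ω + l n ω + η n)) :
    TendstoInMeasure μ f atTop 0 := by
  rw [tendstoInMeasure_iff_norm] at hq hl ⊢
  intro δ hδ
  have hδ' : 0 < δ / (3 * K) := by positivity
  have hlim := ((hq _ hδ').add (hl _ hδ')).add hE
  rw [add_zero, add_zero] at hlim
  refine tendsto_of_tendsto_of_tendsto_of_le_of_le' tendsto_const_nhds hlim
    (Eventually.of_forall fun _ => zero_le) ?_
  filter_upwards [h, hη.eventually_lt_const hδ'] with n hn hηn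
  refine (measure_mono_ae ?_).trans ((measure_union_le _ _).trans
    (add_le_add_left (measure_union_le _ _) _))
  filter_upwards [hn] with ω hω hf
  by_contra hnot
  simp only [Pi.zero_apply, sub_zero, Real.norm_eq_abs] at hnot hf
  have hnot' : ¬ ((δ / (3 * K) ≤ |q n ω| ∨ δ / (3 * K) ≤ |l n ω|) ∨ ω ∈ (E n)ᶜ) := hnot
  push Not at hnot'
  obtain ⟨⟨h1, h2⟩, h3⟩ := hnot'
  have h4 := hω (by simpa using h3)
  have hf' : δ ≤ |f n ω| := hf
  have h5 : q n ω + l n ω + η n < 3 * (δ / (3 * K)) := by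
    linarith [le_abs_self (q n ω), le_abs_self (l n ω)]
  have h6 : K * (q n ω + l n ω + η n) < K * (3 * (δ / (3 * K))) :=
    mul_lt_mul_of_pos_left h5 hK
  have h7 : K * (3 * (δ / (3 * K))) = δ := by field_simp
  linarith

/-- Convergence already holds in `L¹`, since the average squared error has mean at most `σ ^ 2`. -/
lemma tendstoInMeasure_mul_one_add_sqNorm [IsProbabilityMeasure μ] {ε : (n : ℕ) → Fin n → Ω → ℝ} {σ : ℝ}
    (hε : ∀ n i, MemLp (ε n i) 2 μ)
    (hsq : ∀ n i, ∫ ω, ε n i ω ^ 2 ∂μ = σ ^ 2) {ρ : ℕ → ℝ} (hρ : Tendsto ρ atTop (𝓝 0)) :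
    TendstoInMeasure μ (fun n ω => ρ n * (1 + sqNorm (fun i => ε n i ω) / n)) atTop 0 := by
  have hint : ∀ n, Integrable (fun ω => sqNorm (fun i => ε n i ω)) μ := fun n =>
    integrable_finsetSum _ fun i _ => (hε n i).integrable_sq
  have hint' : ∀ n, Integrable (fun ω => 1 + sqNorm (fun i => ε n i ω) / n) μ := fun n =>
    (integrable_const 1).add ((hint n).div_const _)
  have hval : ∀ n, ∫ ω, ‖ρ n * (1 + sqNorm (fun i => ε n i ω) / n)‖ ∂μ
      ≤ |ρ n| * (1 + σ ^ 2) := fun n => by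
    have h1 : ∀ ω, ‖ρ n * (1 + sqNorm (fun i => ε n i ω) / n)‖
        = |ρ n| * (1 + sqNorm (fun i => ε n i ω) / n) := fun ω => by
      rw [norm_mul, Real.norm_eq_abs, Real.norm_of_nonneg]
      exact add_nonneg zero_le_one (div_nonneg (sqNorm_nonneg _) (Nat.cast_nonneg _))
    simp only [h1]
    rw [integral_const_mul, integral_add (integrable_const 1) ((hint n).div_const _),
      integral_div]
    have h2 : ∫ ω, sqNorm (fun i => ε n i ω) ∂μ = n * σ ^ 2 := by
      simp only [sqNorm]
      rw [integral_finsetSum _ fun i _ => (hε n i).integrable_sq]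
      simp [hsq]
    rw [h2]
    gcongr
    · simp
    · exact div_le_of_le_mul₀ (Nat.cast_nonneg _) (sq_nonneg σ) (mul_comm _ _).le
  refine tendstoInMeasure_of_tendsto_eLpNorm one_ne_zero
    (fun n => ((hint' n).const_mul _).aestronglyMeasurable) aestronglyMeasurable_const ?_
  have hlim : Tendsto (fun n => ENNReal.ofReal (|ρ n| * (1 + σ ^ 2))) atTop (𝓝 0) := by
    have := (hρ.abs.mul_const (1 + σ ^ 2))
    rw [abs_zero, zero_mul] at this
    simpa using ENNReal.tendsto_ofReal this
  refine tendsto_of_tendsto_of_tendsto_of_le_of_le tendsto_const_nhds hlim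
    (fun _ => zero_le) fun n => ?_
  have : (fun ω => ρ n * (1 + sqNorm (fun i => ε n i ω) / n)) - (0 : Ω → ℝ)
      = fun ω => ρ n * (1 + sqNorm (fun i => ε n i ω) / n) := sub_zero _
  simp only [this]
  rw [eLpNorm_one_eq_lintegral_enorm,
    ← ofReal_integral_norm_eq_lintegral_enorm ((hint' n).const_mul _)]
  exact ENNReal.ofReal_le_ofReal (hval n)

end Probability

end MOCE

/-! ### Rates and assembly of the theorem. -/

theorem theorem2
    {Ω : Type*} [MeasurableSpace Ω] (μ : Measure Ω) [IsProbabilityMeasure μ]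
    -- dimensions, designs, coefficients; for each sample size n the model y = X β + ε
    (p : ℕ → ℕ) (hp : Tendsto p atTop atTop)
    (X : (n : ℕ) → Matrix (Fin n) (Fin (p n)) ℝ)
    (β : (n : ℕ) → Fin (p n) → ℝ)
    (ε : (n : ℕ) → Fin n → Ω → ℝ)
    (σ : ℝ) (hσ : 0 < σ)
    (hε_meas : ∀ n i, Measurable (ε n i))
    (hε_indep : ∀ n, iIndepFun (ε n) μ)
    (hε_mean : ∀ n i, μ[ε n i] = 0)
    (hε_var : ∀ n i, Var[ε n i; μ] = σ ^ 2)
    (y : (n : ℕ) → Ω → Fin n → ℝ)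
    (hy : ∀ n ω, y n ω = X n *ᵥ β n + fun i => ε n i ω)
    -- the LASSO estimator and its tuning parameter
    (lam : ℕ → ℝ) (hlam_pos : ∀ᶠ n in atTop, 0 < lam n)
    (hlam : lam =Θ[atTop] fun n => √(Real.log (p n) / n))
    (bhat : (n : ℕ) → Ω → Fin (p n) → ℝ)
    (hbhat_meas : ∀ n, Measurable (bhat n))
    (hbhat : ∀ᶠ n in atTop, ∀ᵐ ω ∂μ, MOCE.IsLasso (X n) (y n ω) (lam n) (bhat n ω))
    -- the expanded model, the ridge parameters, and the direction d
    (A : (n : ℕ) → Finset (Fin (p n)))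
    (τa τc : ℕ → ℝ)
    (hτa_pos : ∀ᶠ n in atTop, 0 < τa n)
    (hτa : τa =o[atTop] fun n => √(Real.log (p n)) / n)
    (hτc_pos : ∃ c > 0, ∀ᶠ n in atTop, c ≤ τc n)
    (hτc : τc =O[atTop] fun n => √(MOCE.sparseEigMax (X n) (p n - (A n).card)))
    (m : ℕ) (d : (n : ℕ) → Fin (p n) → ℝ)
    (hd_norm : ∀ᶠ n in atTop, MOCE.twoNorm (d n) = 1)
    (hd_sparse : ∀ᶠ n in atTop, (MOCE.support (d n)).card ≤ m)
    -- sparsity: a = o(n / log p)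
    (ha : (fun n => ((MOCE.support (β n)).card : ℝ)) =o[atTop]
      fun n => (n : ℝ) / Real.log (p n))
    -- restricted eigenvalues RE(a, 3)
    (hRE : ∃ φ₀ > 0, ∀ᶠ n in atTop,
      MOCE.RestrictedEigenvalue (X n) (MOCE.support (β n)).card 3 φ₀)
    -- sparse eigenvalues SE(max(ã, â))
    (hSE : ∃ c > 0, ∃ C : ℝ, Tendsto (fun n => μ {ω | MOCE.SparseEigenvalue (X n)
      (max (A n).card (MOCE.support (bhat n ω)).card) c C}) atTop (𝓝 1))
    -- λ_max(b_fn) is bounded, b_fn being the number of signals missed by the expanded model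
    (hfn : ∃ C : ℝ, ∀ᶠ n in atTop,
      MOCE.sparseEigMax (X n) (MOCE.support (β n) ∩ (A n)ᶜ).card ≤ C)
    -- the signals above the threshold that the expanded model misses are o(n^{-1/2})
    (hmiss : (fun n => MOCE.twoNorm
        (MOCE.restrict ((A n)ᶜ ∩ MOCE.signalSet n σ (β n)) (β n))) =o[atTop]
      fun n => 1 / √(n : ℝ))
    -- √â ‖β̂ on Ãᶜ ∩ Â‖_∞ = o_p(n^{-1/2}); the norm on functions is the sup norm
    (hleak : TendstoInMeasure μ (fun (n : ℕ) ω => √(n : ℝ) *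
        (√((MOCE.support (bhat n ω)).card : ℝ) *
          ‖MOCE.restrict ((A n)ᶜ ∩ MOCE.support (bhat n ω)) (bhat n ω)‖)) atTop 0)
    -- bounded r-th moments and negligible weights
    (r : ℝ) (hr : 2 < r)
    (hmom : ∃ M : ℝ, ∀ n i, Integrable (fun ω => |ε n i ω| ^ r) μ ∧
      ∫ ω, |ε n i ω| ^ r ∂μ ≤ M)
    (hw : Tendsto (fun n => ⨆ i : Fin n,
      MOCE.moceWeight (X n) (A n) (τa n) (τc n) (d n) i ^ 2 /
        ∑ k, MOCE.moceWeight (X n) (A n) (τa n) (τc n) (d n) k ^ 2) atTop (𝓝 0))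
    -- the standard deviation v
    (v : ℕ → ℝ)
    (hv : ∀ n, v n = √(MOCE.moceVar (X n) (A n) (τa n) (τc n) σ (d n)))
    (hv_pos : ∃ v₀ > 0, ∀ᶠ n in atTop, v₀ ≤ v n) :
    -- the expansion
    TendstoInMeasure μ (fun (n : ℕ) ω =>
        MOCE.studentized n (v n) (d n)
          (MOCE.moceEstimator (X n) (y n ω) (lam n) (A n) (τa n) (τc n) (bhat n ω)) (β n)
        - MOCE.leadingTerm (X n) (A n) (τa n) (τc n) (v n) (d n) (fun i => ε n i ω))
      atTop 0 ∧
    -- the leading term is asymptotically N(0, 1)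
    TendstoInDistribution (fun (n : ℕ) ω =>
        MOCE.leadingTerm (X n) (A n) (τa n) (τc n) (v n) (d n) (fun i => ε n i ω))
      atTop id (fun _ => μ) (gaussianReal 0 1) ∧
    -- hence so is the studentized MOCE estimator
    TendstoInDistribution (fun (n : ℕ) ω =>
        MOCE.studentized n (v n) (d n)
          (MOCE.moceEstimator (X n) (y n ω) (lam n) (A n) (τa n) (τc n) (bhat n ω)) (β n))
      atTop id (fun _ => μ) (gaussianReal 0 1) := by
  have hL2 : ∀ n i, MemLp (ε n i) 2 μ := fun n i =>
    memLp_two_of_variance_ne_zero (hε_meas n i).aestronglyMeasurable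
      (by rw [hε_var]; positivity)
  have hsq : ∀ n i, ∫ ω, ε n i ω ^ 2 ∂μ = σ ^ 2 := fun n i => by
    rw [← hε_var n i, variance_of_integral_eq_zero (hε_meas n i).aemeasurable (hε_mean n i)]
  have hε_meas' : ∀ n, Measurable fun ω i => ε n i ω := fun n =>
    measurable_pi_iff.2 fun i => hε_meas n i
  have hy_meas : ∀ n, Measurable (y n) := fun n => by
    rw [funext (hy n)]
    exact measurable_const.add (hε_meas' n)
  have hrate : Tendsto (fun n : ℕ =>
      √(Real.log (p n) / n) * √((MOCE.support (β n)).card : ℝ)) atTop (𝓝 0) := by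
    have h := (Real.continuous_sqrt.tendsto 0).comp ha.tendsto_div_nhds_zero
    rw [Real.sqrt_zero] at h
    refine h.congr fun n => ?_
    rw [Function.comp_apply, ← Real.sqrt_mul
      (div_nonneg (Real.log_natCast_nonneg _) (Nat.cast_nonneg _))]
    congr 1
    rw [div_div_eq_mul_div]
    ring
  have hsmall : ∀ᶠ n in atTop, lam n * √((MOCE.support (β n)).card : ℝ) ≤ 1 := by
    have h := (hlam.isBigO.mul (isBigO_refl (fun n => √((MOCE.support (β n)).card : ℝ))
      atTop)).trans_tendsto hrate
    exact h.eventually_le_const one_pos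
  -- The rate `√n τa = o(√(log p / n)) = o(lam)` compensates for the factor `1 / lam` in the crude
  -- LASSO bound.
  have hρ : Tendsto (fun n : ℕ => √(n : ℝ) * τa n / lam n) atTop (𝓝 0) := by
    have h1 := (isBigO_refl (fun n : ℕ => √(n : ℝ)) atTop).mul_isLittleO hτa
    have h2 : (fun n : ℕ => √(n : ℝ) * (√(Real.log (p n)) / n))
        = fun n : ℕ => √(Real.log (p n) / n) := by
      ext n
      rw [Real.sqrt_div (Real.log_natCast_nonneg _), mul_div_left_comm, Real.sqrt_div_self',
        mul_one_div]
    rw [h2] at h1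
    exact (h1.trans_isBigO hlam.isBigO_symm).tendsto_div_nhds_zero
  have hη : Tendsto (fun n : ℕ => √(n : ℝ) * MOCE.twoNorm (MOCE.restrict (A n)ᶜ (β n)))
      atTop (𝓝 0) := by
    have h := hmiss.tendsto_div_nhds_zero.add (hrate.const_mul (√2 * σ))
    rw [mul_zero, add_zero] at h
    refine squeeze_zero
      (fun n => mul_nonneg (Real.sqrt_nonneg _) (MOCE.twoNorm_nonneg _)) (fun n => ?_) h
    simpa using MOCE.twoNorm_restrict_compl_le_add hσ.le (β n)
  obtain ⟨t, ht, hτc_le⟩ := hτc_pos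
  obtain ⟨φ, hφ, hRE⟩ := hRE
  obtain ⟨c, hc, C, hSE⟩ := hSE
  obtain ⟨C', hfn⟩ := hfn
  obtain ⟨v₀, hv₀, hv_le⟩ := hv_pos
  have hE : Tendsto (fun n => μ {ω | MOCE.SparseEigenvalue (X n)
      (max (A n).card (MOCE.support (bhat n ω)).card) c C}ᶜ) atTop (𝓝 0) := by
    have h := ENNReal.Tendsto.sub (tendsto_const_nhds (x := (1 : ENNReal))) hSE
      (Or.inl ENNReal.one_ne_top)
    rw [tsub_self] at h
    refine h.congr fun n => (prob_compl_eq_one_sub ?_).symm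
    -- The event depends on `ω` only through the natural number `â`, and every set of naturals is
    -- measurable.
    exact MOCE.measurable_card_support (hbhat_meas n) (MeasurableSet.of_discrete
      (s := {k | MOCE.SparseEigenvalue (X n) (max (A n).card k) c C}))
  have hexp : TendstoInMeasure μ (fun (n : ℕ) ω =>
        MOCE.studentized n (v n) (d n)
          (MOCE.moceEstimator (X n) (y n ω) (lam n) (A n) (τa n) (τc n) (bhat n ω)) (β n)
        - MOCE.leadingTerm (X n) (A n) (τa n) (τc n) (v n) (d n) (fun i => ε n i ω))
      atTop 0 := by
    refine MOCE.tendstoInMeasure_zero_of_abs_le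
      (K := v₀⁻¹ * ((1 + √C * √(1 / t)) / c * (1 + 2 / √φ + 2 / φ)
            + ((1 + √C * √(1 / t)) / c * (√C * √C) + 1)
            + ((1 + √C * √(1 / t)) / c * (√C * √C') + 1))) (by positivity)
      (MOCE.tendstoInMeasure_mul_one_add_sqNorm hL2 hsq hρ) hleak hη hE ?_
    filter_upwards [eventually_gt_atTop 0, hlam_pos, hbhat, hτa_pos, hτc_le, hd_norm, hRE, hfn,
      hsmall, hv_le] with n hn hlamn hbn hτan hτcn hdn hREn hfnn hsmalln hvn
    filter_upwards [hbn] with ω hω hSEω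
    rw [hy] at hω ⊢
    exact MOCE.mul_abs_remainder_le hn hlamn hφ hc ht hv₀ hvn hdn hREn hω hsmalln hSEω hfnn
      hτan hτcn
  have hv_sq : ∀ n, v n ^ 2
      = σ ^ 2 * ∑ i, MOCE.moceWeight (X n) (A n) (τa n) (τc n) (d n) i ^ 2 := fun n => by
    rw [hv, MOCE.moceVar_eq_sum, Real.sq_sqrt]
    exact mul_nonneg (sq_nonneg _) (Finset.sum_nonneg fun _ _ => sq_nonneg _)
  have hclt : TendstoInDistribution (fun (n : ℕ) ω =>
        MOCE.leadingTerm (X n) (A n) (τa n) (τc n) (v n) (d n) (fun i => ε n i ω))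
      atTop id (fun _ => μ) (gaussianReal 0 1) := by
    simp only [MOCE.leadingTerm_eq_sum]
    refine MOCE.tendstoInDistribution_weighted_sum ε hσ hε_meas hε_indep hε_mean hε_var hr hmom
      (fun n i => (v n)⁻¹ * MOCE.moceWeight (X n) (A n) (τa n) (τc n) (d n) i) ?_ ?_
    · filter_upwards [hv_le] with n hn
      simp only [mul_pow, ← Finset.mul_sum]
      rw [mul_left_comm, ← hv_sq, ← mul_pow, inv_mul_cancel₀ (hv₀.trans_le hn).ne', one_pow]
    -- By `hv_sq`, the squared coefficients are the normalized weights of `hw` divided by `σ ^ 2`.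
    · have h := hw.const_mul (σ ^ 2)⁻¹
      rw [mul_zero] at h
      refine h.congr fun n => ?_
      rw [Real.mul_iSup_of_nonneg (by positivity)]
      congr 1
      ext i
      rw [mul_pow, inv_pow, hv_sq, mul_inv]
      ring
  -- Slutsky's theorem.
  refine ⟨hexp, hclt, tendstoInDistribution_of_tendstoInMeasure_sub _ _ hclt hexp fun n => ?_⟩
  exact (MOCE.measurable_studentized _ _ _ _ _ _ _ _ (hy_meas n) (hbhat_meas n)).aemeasurable
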